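/- **P systems with simplex channels.** Let $O$ be a finite alphabet and $K$ a finite set of cells, connected by the arcs of an irreflexive relation $\delta\subseteq K\times K$ (an arc goes from a parent to a child). A *complex symbol* is an elementary symbol of $O$, a cell index, a natural number, or a tuple of complex symbols. All cells have the same finite state set $Q$ and the same finite list of generic rules, ordered by priority, of the form $$S\;x\;\to_{\alpha.\beta}\;S'\;x'\;(y)_{\downarrow_\forall}\;|\;z ,\qquad \alpha,\beta\in\{\min,\max\},$$ where $S,S'\in Q$ and $x,x',y,z$ are finite multisets of complex symbols with free variables (for arbitrary symbols, or for numbers, of which sums and constants may be formed), each of which occurs in $x$ or $z$, and $x\neq\emptyset$ if $\beta=\max$. A rule cannot name a particular cell; it can refer to the index $i$ of the cell in which it is applied, through the immutable promoter $\iota_i$ (the reified cell ID). The rule consumes $x$, produces $x'$ (visible from the next step on), sends a copy of $y$ to every child, and needs the promoters $z$ in the content of the cell at the start of the step, without consuming them. It is instantiated once ($\alpha=\min$) or by all possible distinct instances ($\alpha=\max$), and each chosen instance is applied once ($\beta=\min$) or as many times as possible ($\beta=\max$); choices are nondeterministic. In each step, all cells act synchronously: in every cell, the rules whose source is the current state are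 tried in order of priority on the symbols not yet consumed in this step, and a rule is skipped if its target state differs from that of the rules already applied in this step. **Theorem.** There are a finite alphabet $O$ with two distinct symbols $a,c\in O$, a finite state set $Q$ with two distinct states $S_0,S_f$, a fixed finite rule list $R$ as above, and a constant $C$ with the following properties. 1. $S_0$ is quiescent (a cell in state $S_0$ that contains, besides its ID, only copies of $c$, possibly none, has no applicable rule), and $S_f$ is final (a cell in state $S_f$ has no applicable rule). 2. Let $\delta$ be any strongly connected digraph without loops on any finite set $K$ of cells, and let $g\in K$ (the general). Start all cells $i\in K$ in state $S_0$ with content $\iota_i\,c^{\mathrm{outdegree}(i)}$, the general with one additional copy of $a$. Then every evolution terminates, and during its last step, step $T\ge 1$, all cells enter $S_f$ simultaneously and for the first time. 3. If $K$ has at least two cells, then $T\le C\, e_g D$, where $e_g$ is the eccentricity of $g$ (the largest directed distance from $g$ to a cell) and $D$ is the diameter of $\delta$. That is, the firing squad synchronization problem for P systems with simplex channels on strongly connected digraphs, with reified cell IDs and outdegree counts, is solved by a fixed rule set, independent of the size and the structure of the digraph, in $O(e_g D)$ steps. -/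

import Mathlib

/-! # P systems with simplex channels, reified cell IDs and generic rules -/

namespace PSystem

/-- Complex symbols: recursive compositions (tuples, nested to the right) of elementary symbols from
the alphabet `O`, indices of cells, and natural numbers (the numeric subscripts). -/
inductive Sym (O K : Type) : Type
  | elem (a : O)
  | id (i : K)
  | num (n : ℕ)
  | pair (s t : Sym O K)

/-- Numeric subscripts of a generic rule, over `n` free number variables (such as `k`, `k + 1`,
`k + l`). -/
inductive NumExp (n : ℕ) : Type
  | const (a : ℕ)
  | var (v : Fin n)
  | add (e f : NumExp n)

/-- Complex symbols of a generic rule with `s` free symbol variables, which match any symbol, and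
`n` free number variables. A rule cannot name a particular cell; `self` is the index `i` of the
current cell, bound by the promoter `ι_i`. As the cell ID symbol `ι_i` is accessible as an immutable
promoter only, this is the only access of the rules to it. -/
inductive Pat (O : Type) (s n : ℕ) : Type
  | elem (a : O)
  | self
  | var (v : Fin s)
  | num (e : NumExp n)
  | pair (p q : Pat O s n)

def NumExp.eval {n : ℕ} (ν : Fin n → ℕ) : NumExp n → ℕ
  | .const a => a
  | .var v => ν v
  | .add e f => e.eval ν + f.eval ν

def Pat.eval {O K : Type} {s n : ℕ} (i : K) (σ : Fin s → Sym O K) (ν : Fin n → ℕ) :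
    Pat O s n → Sym O K
  | .elem a => .elem a
  | .self => .id i
  | .var v => σ v
  | .num e => .num (e.eval ν)
  | .pair p q => .pair (p.eval i σ ν) (q.eval i σ ν)

/-- The number variable `v` occurs in the expression. -/
def NumExp.Occurs {n : ℕ} (v : Fin n) : NumExp n → Prop
  | .const _ => False
  | .var u => u = v
  | .add e f => e.Occurs v ∨ f.Occurs v

/-- The symbol variable `v` occurs in the pattern. -/
def Pat.OccursSym {O : Type} {s n : ℕ} (v : Fin s) : Pat O s n → Prop
  | .elem _ => False
  | .self => False
  | .var u => u = v
  | .num _ => False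
  | .pair p q => p.OccursSym v ∨ q.OccursSym v

/-- The number variable `v` occurs in the pattern. -/
def Pat.OccursNum {O : Type} {s n : ℕ} (v : Fin n) : Pat O s n → Prop
  | .elem _ => False
  | .self => False
  | .var _ => False
  | .num e => e.Occurs v
  | .pair p q => p.OccursNum v ∨ q.OccursNum v

/-- The two operators `min` (once) and `max` (as many times as possible), used both for
instantiation and for rewriting. -/
inductive Mode : Type
  | min
  | max

/-- A generic rule `S x →_{inst.rew} S' x' (y)↓∀ | z`. Every free variable occurs in `x` or in `z`,
and a rule with rewriting mode `max` consumes something, so that "as many as possible" is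
meaningful. A rule without free variables is an ordinary rule, with rewriting mode `rew`. -/
structure Rule (O Q : Type) : Type where
  source : Q
  target : Q
  inst : Mode
  rew : Mode
  symVars : ℕ
  numVars : ℕ
  /-- `x`: the symbols that are rewritten. -/
  lhs : List (Pat O symVars numVars)
  /-- `x'`: the symbols that replace them. -/
  rhs : List (Pat O symVars numVars)
  /-- `y`: the symbols that are sent to each child. -/
  send : List (Pat O symVars numVars)
  /-- `z`: the promoters (other than the cell ID). -/
  promoter : List (Pat O symVars numVars)
  symVars_bound : ∀ v, ∃ p ∈ lhs ++ promoter, p.OccursSym v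
  numVars_bound : ∀ v, ∃ p ∈ lhs ++ promoter, p.OccursNum v
  lhs_ne_nil : rew = .max → lhs ≠ []

/-- A lower-level rule, without its states and modes. -/
structure Ground (O K : Type) : Type where
  consume : Multiset (Sym O K)
  produce : Multiset (Sym O K)
  send : Multiset (Sym O K)
  promote : Multiset (Sym O K)

/-- The instance of a generic rule in cell `i` under an assignment of its free variables. -/
def Rule.ground {O Q K : Type} (r : Rule O Q) (i : K) (σ : Fin r.symVars → Sym O K)
    (ν : Fin r.numVars → ℕ) : Ground O K where
  consume := ↑(r.lhs.map (Pat.eval i σ ν))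
  produce := ↑(r.rhs.map (Pat.eval i σ ν))
  send := ↑(r.send.map (Pat.eval i σ ν))
  promote := ↑(r.promoter.map (Pat.eval i σ ν))

/-- The instances of `r` in cell `i` whose promoters are present in the content `w`. -/
def Rule.instances {O Q K : Type} (r : Rule O Q) (i : K) (w : Multiset (Sym O K)) :
    Set (Ground O K) :=
  {g | (∃ σ ν, g = r.ground i σ ν) ∧ g.promote ≤ w}

/-- `r` is applicable in cell `i` with state `S` and content `w`. -/
def Rule.Applicable {O Q K : Type} (r : Rule O Q) (i : K) (S : Q) (w : Multiset (Sym O K)) : Prop :=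
  r.source = S ∧ ∃ g ∈ r.instances i w, g.consume ≤ w

/-- `apps` is a possible multiset of applications of `r`, given the content `w` at the start of the
step and the symbols `u` not yet consumed in this step: with instantiation mode `min` there is at
most one instance; with rewriting mode `min` each instance is applied at most once. -/
structure Rule.Admissible {O Q K : Type} (r : Rule O Q) (i : K) (w u : Multiset (Sym O K))
    (apps : Multiset (Ground O K)) : Prop where
  mem_instances : ∀ g ∈ apps, g ∈ r.instances i w
  consume_le : (apps.map Ground.consume).sum ≤ u
  inst_min : r.inst = .min → ∀ g ∈ apps, ∀ h ∈ apps, g = h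
  rew_min : r.rew = .min → apps.Nodup

/-- A possible multiset of applications to which no application can be added: "once, if possible"
or "as many as possible", according to the two modes of the rule. -/
def Rule.IsApplication {O Q K : Type} (r : Rule O Q) (i : K) (w u : Multiset (Sym O K))
    (apps : Multiset (Ground O K)) : Prop :=
  r.Admissible i w u apps ∧ ∀ g, ¬ r.Admissible i w u (g ::ₘ apps)

/-- The state of a cell in the course of one step: the target state assigned so far (if any), the
symbols not yet consumed, the symbols produced (not visible before the next step), and the symbols
sent to every child. -/
structure Partial (O Q K : Type) : Type where
  target : Option Q
  avail : Multiset (Sym O K)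
  made : Multiset (Sym O K)
  sent : Multiset (Sym O K)

/-- The turn of rule `r` in a step of cell `i` from state `S` and content `w`. The rule takes part
if its source is `S` and its target is the target state assigned by the previous rules (if any). -/
def Rule.Turn {O Q K : Type} (r : Rule O Q) (i : K) (S : Q) (w : Multiset (Sym O K))
    (a b : Partial O Q K) : Prop :=
  ((r.source = S ∧ ∀ T ∈ a.target, T = r.target) ∧
    ∃ apps, r.IsApplication i w a.avail apps ∧
      a.avail = (apps.map Ground.consume).sum + b.avail ∧
      b.made = a.made + (apps.map Ground.produce).sum ∧
      b.sent = a.sent + (apps.map Ground.send).sum ∧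
      (apps = 0 → b.target = a.target) ∧ (apps ≠ 0 → b.target = some r.target)) ∨
  (¬ (r.source = S ∧ ∀ T ∈ a.target, T = r.target) ∧ b = a)

/-- The rules have their turns in the order of their priorities (weak priority). -/
def Turns {O Q K : Type} (i : K) (S : Q) (w : Multiset (Sym O K)) :
    List (Rule O Q) → Partial O Q K → Partial O Q K → Prop
  | [], a, b => b = a
  | r :: rs, a, b => ∃ c, r.Turn i S w a c ∧ Turns i S w rs c b

/-- In one step, cell `i` goes from state `S` and content `w` to state `S'` and content `w'` (before
the messages of its parents are added), and sends `y` to each of its children. -/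
def CellStep {O Q K : Type} (R : List (Rule O Q)) (i : K) (S : Q) (w : Multiset (Sym O K))
    (S' : Q) (w' y : Multiset (Sym O K)) : Prop :=
  ∃ b, Turns i S w R ⟨none, w, 0, 0⟩ b ∧ S' = b.target.getD S ∧ w' = b.avail + b.made ∧ y = b.sent

/-- A configuration: the current state and the current content of each cell. -/
abbrev Config (O Q K : Type) : Type := K → Q × Multiset (Sym O K)

open Classical in
/-- One global synchronous step, where `δ i j` says that there is an arc from parent `i` to
child `j`. -/
def Step {O Q K : Type} [Fintype K] (R : List (Rule O Q)) (δ : K → K → Prop)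
    (C C' : Config O Q K) : Prop :=
  ∃ w' y : K → Multiset (Sym O K),
    ∀ j, CellStep R j (C j).1 (C j).2 (C' j).1 (w' j) (y j) ∧
      (C' j).2 = w' j + ∑ i with δ i j, y i

/-- No cell can evolve. -/
def Halted {O Q K : Type} (R : List (Rule O Q)) (C : Config O Q K) : Prop :=
  ∀ i, ∀ r ∈ R, ¬ r.Applicable i (C i).1 (C i).2

/-- An evolution from configuration `C₀`; after halting, the configuration is repeated forever. -/
def IsEvolution {O Q K : Type} [Fintype K] (R : List (Rule O Q)) (δ : K → K → Prop)
    (C₀ : Config O Q K) (ev : ℕ → Config O Q K) : Prop :=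
  ev 0 = C₀ ∧ ∀ t, Step R δ (ev t) (ev (t + 1))

/-! ## Every configuration has a successor -/

def Sym.size {O K : Type} : Sym O K → ℕ
  | .elem _ => 0
  | .id _ => 0
  | .num n => n
  | .pair s t => s.size + t.size + 1

theorem Sym.finite_size_le {O K : Type} [Finite O] [Finite K] (N : ℕ) :
    {s : Sym O K | s.size ≤ N}.Finite := by
  induction N with
  | zero =>
    refine (((Set.finite_range (Sym.elem (O := O) (K := K))).union
      (Set.finite_range (Sym.id (O := O) (K := K)))).union (Set.finite_singleton (.num 0))).subset ?_
    rintro (a | i | n | ⟨s, t⟩) h <;> simp_all [Sym.size]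
  | succ N ih =>
    refine ((((Set.finite_range (Sym.elem (O := O) (K := K))).union
      (Set.finite_range (Sym.id (O := O) (K := K)))).union
      ((Set.finite_Iic (N + 1)).image Sym.num)).union (ih.image2 Sym.pair ih)).subset ?_
    rintro (a | i | n | ⟨s, t⟩) h
    · simp
    · simp
    · simp_all [Sym.size]
    · right
      simp only [Set.mem_ofPred_eq, Sym.size] at h
      exact ⟨s, by simp only [Set.mem_ofPred_eq]; omega, t, by simp only [Set.mem_ofPred_eq]; omega, rfl⟩

theorem NumExp.le_eval {n : ℕ} (ν : Fin n → ℕ) (v : Fin n) (e : NumExp n) (h : e.Occurs v) :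
    ν v ≤ e.eval ν := by
  induction e with
  | const a => exact h.elim
  | var u => cases h; exact le_rfl
  | add e f he hf =>
    simp only [NumExp.eval]
    rcases h with h | h
    · have := he h; omega
    · have := hf h; omega

theorem Pat.size_le_eval {O K : Type} {s n : ℕ} (i : K) (σ : Fin s → Sym O K) (ν : Fin n → ℕ)
    (v : Fin s) (p : Pat O s n) (h : p.OccursSym v) : (σ v).size ≤ (p.eval i σ ν).size := by
  induction p with
  | elem | self | num => exact h.elim
  | var u => cases h; exact le_rfl
  | pair p q hp hq =>
    simp only [Pat.eval, Sym.size]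
    rcases h with h | h
    · have := hp h; omega
    · have := hq h; omega

theorem Pat.num_le_eval {O K : Type} {s n : ℕ} (i : K) (σ : Fin s → Sym O K) (ν : Fin n → ℕ)
    (v : Fin n) (p : Pat O s n) (h : p.OccursNum v) : ν v ≤ (p.eval i σ ν).size := by
  induction p with
  | elem | self | var => exact h.elim
  | num e => exact e.le_eval ν v h
  | pair p q hp hq =>
    simp only [Pat.eval, Sym.size]
    rcases h with h | h
    · have := hp h; omega
    · have := hq h; omega

theorem Rule.finite_instances {O Q K : Type} [Finite O] [Finite K] (r : Rule O Q) (i : K)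
    (w u : Multiset (Sym O K)) : {g ∈ r.instances i w | g.consume ≤ u}.Finite := by
  set N := ((w + u).map Sym.size).sum with hN
  have hσ : (Set.univ.pi fun _ : Fin r.symVars => {s : Sym O K | s.size ≤ N}).Finite :=
    Set.Finite.pi fun _ => Sym.finite_size_le N
  have hν : (Set.univ.pi fun _ : Fin r.numVars => Set.Iic N).Finite :=
    Set.Finite.pi fun _ => Set.finite_Iic N
  refine (hσ.image2 (fun σ ν => r.ground i σ ν) hν).subset ?_
  rintro g ⟨⟨⟨σ, ν, rfl⟩, hw⟩, hu⟩
  have key : ∀ p ∈ r.lhs ++ r.promoter, (p.eval i σ ν).size ≤ N := by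
    intro p hp
    refine Multiset.single_le_sum (by simp) _ (Multiset.mem_map_of_mem _ ?_)
    rw [Multiset.mem_add]
    rcases List.mem_append.1 hp with hp | hp
    · exact Or.inr (Multiset.mem_of_le hu (by simpa [Rule.ground] using ⟨p, hp, rfl⟩))
    · exact Or.inl (Multiset.mem_of_le hw (by simpa [Rule.ground] using ⟨p, hp, rfl⟩))
  refine ⟨σ, fun v _ => ?_, ν, fun v _ => ?_, rfl⟩
  · obtain ⟨p, hp, hv⟩ := r.symVars_bound v
    exact (p.size_le_eval i σ ν v hv).trans (key p hp)
  · obtain ⟨p, hp, hv⟩ := r.numVars_bound v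
    exact (p.num_le_eval i σ ν v hv).trans (key p hp)

theorem Rule.exists_isApplication {O Q K : Type} [Finite O] [Finite K] (r : Rule O Q) (i : K)
    (w u : Multiset (Sym O K)) : ∃ apps, r.IsApplication i w u apps := by
  classical
  have hb : ∃ B, ∀ apps, r.Admissible i w u apps → apps.card ≤ B := by
    cases hr : r.rew with
    | min =>
      refine ⟨(r.finite_instances i w u).toFinset.card, fun apps h => ?_⟩
      have hn := h.rew_min hr
      rw [← Multiset.toFinset_card_of_nodup hn]
      refine Finset.card_le_card fun g hg => ?_
      rw [Multiset.mem_toFinset] at hg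
      rw [Set.Finite.mem_toFinset]
      exact ⟨h.mem_instances g hg,
        (Multiset.le_sum_of_mem (Multiset.mem_map_of_mem _ hg)).trans h.consume_le⟩
    | max =>
      refine ⟨u.card, fun apps h => ?_⟩
      have h1 := Multiset.card_le_card h.consume_le
      refine le_trans ?_ h1
      have h2 : ∀ g ∈ apps, 1 ≤ g.consume.card := by
        intro g hg
        obtain ⟨⟨σ, ν, rfl⟩, -⟩ := h.mem_instances g hg
        simpa [Rule.ground, Nat.one_le_iff_ne_zero] using r.lhs_ne_nil hr
      clear h h1
      induction apps using Multiset.induction with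
      | empty => simp
      | cons g s ih =>
        have := h2 g (by simp)
        have := ih fun g hg => h2 g (Multiset.mem_cons_of_mem hg)
        simp only [Multiset.card_cons, Multiset.map_cons, Multiset.sum_cons, Multiset.card_add]
        omega
  obtain ⟨B, hB⟩ := hb
  by_contra! hne
  have : ∀ m, ∃ apps, r.Admissible i w u apps ∧ apps.card = m := by
    intro m
    induction m with
    | zero => exact ⟨0, ⟨by simp, by simp, by simp, by simp⟩, by simp⟩
    | succ m ih =>
      obtain ⟨apps, ha, hc⟩ := ih
      have := hne apps
      simp only [Rule.IsApplication, not_and, not_forall, not_not] at this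
      obtain ⟨g, hg⟩ := this ha
      exact ⟨_, hg, by simp [hc]⟩
  obtain ⟨apps, ha, hc⟩ := this (B + 1)
  have := hB apps ha
  omega

theorem Turns.exists {O Q K : Type} [Finite O] [Finite K] (i : K) (S : Q)
    (w : Multiset (Sym O K)) (R : List (Rule O Q)) (a : Partial O Q K) :
    ∃ b, Turns i S w R a b := by
  classical
  induction R generalizing a with
  | nil => exact ⟨a, rfl⟩
  | cons r R ih =>
    have : ∃ c, r.Turn i S w a c := by
      by_cases h : r.source = S ∧ ∀ T ∈ a.target, T = r.target
      · obtain ⟨apps, ha⟩ := r.exists_isApplication i w a.avail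
        obtain ⟨rest, hr⟩ := Multiset.le_iff_exists_add.1 ha.1.consume_le
        exact ⟨⟨if apps = 0 then a.target else some r.target, rest,
          a.made + (apps.map Ground.produce).sum, a.sent + (apps.map Ground.send).sum⟩,
          Or.inl ⟨h, apps, ha, hr, rfl, rfl, fun h => if_pos h, fun h => if_neg h⟩⟩
      · exact ⟨a, Or.inr ⟨h, rfl⟩⟩
    obtain ⟨c, hc⟩ := this
    obtain ⟨b, hb⟩ := ih c
    exact ⟨b, c, hc, hb⟩

theorem exists_step {O Q K : Type} [Finite O] [Fintype K] (R : List (Rule O Q)) (δ : K → K → Prop)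
    (C : Config O Q K) : ∃ C', Step R δ C C' := by
  classical
  choose b hb using fun j => Turns.exists j (C j).1 (C j).2 R ⟨none, (C j).2, 0, 0⟩
  exact ⟨fun j => ((b j).target.getD (C j).1, ((b j).avail + (b j).made) + ∑ i with δ i j, (b i).sent),
    fun j => (b j).avail + (b j).made, fun j => (b j).sent,
    fun j => ⟨⟨b j, hb j, rfl, rfl, rfl⟩, rfl⟩⟩

/-- Evolutions exist, from any initial configuration. -/
theorem exists_isEvolution {O Q K : Type} [Finite O] [Fintype K] (R : List (Rule O Q))
    (δ : K → K → Prop) (C₀ : Config O Q K) : ∃ ev, IsEvolution R δ C₀ ev := by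
  choose f hf using exists_step (K := K) R δ
  exact ⟨fun t => Nat.rec C₀ (fun _ C => f C) t, rfl, fun t => hf _⟩

/-! ## Digraphs -/

/-- There is a directed walk with `n` arcs from `i` to `j`. -/
def WalkOfLength {K : Type} (δ : K → K → Prop) : ℕ → K → K → Prop
  | 0, i, j => i = j
  | n + 1, i, j => ∃ k, WalkOfLength δ n i k ∧ δ k j

def StronglyConnected {K : Type} (δ : K → K → Prop) : Prop :=
  ∀ i j, ∃ n, WalkOfLength δ n i j

/-- The distance from `i` to `j`: the least length of a directed walk. -/
noncomputable def dist {K : Type} (δ : K → K → Prop) (i j : K) : ℕ :=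
  sInf {n | WalkOfLength δ n i j}

/-- The eccentricity of `i`: the largest distance from `i` to a cell. -/
noncomputable def ecc {K : Type} [Fintype K] (δ : K → K → Prop) (i : K) : ℕ :=
  Finset.univ.sup fun j => dist δ i j

/-- The diameter: the largest distance between two cells. -/
noncomputable def diam {K : Type} [Fintype K] (δ : K → K → Prop) : ℕ :=
  Finset.univ.sup fun i => ecc δ i

noncomputable def outdegree {K : Type} (δ : K → K → Prop) (i : K) : ℕ :=
  {j | δ i j}.ncard

/-! ## The firing squad synchronization problem -/

/-- A cell prototype over the alphabet `O` with state set `Q`: a finite list of rules in the order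
of their priorities, a quiescent and a final state, a symbol `count` that reifies the outdegree, and
a symbol `start` that marks the general. It does not depend on the cells or on the digraph. -/
structure Prototype (O Q : Type) : Type where
  rules : List (Rule O Q)
  quiescent : Q
  final : Q
  count : O
  start : O
  quiescent_ne_final : quiescent ≠ final
  count_ne_start : count ≠ start
  /-- In the quiescent state, a cell which holds nothing but copies of the counting symbol (such as
  a cell other than the general in its initial configuration) has no applicable rule. -/
  isQuiescent : ∀ (K : Type) (i : K) (d : ℕ), ∀ r ∈ rules,
    ¬ r.Applicable i quiescent (Multiset.replicate d (Sym.elem count))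
  /-- In the final state, no rule is applicable. -/
  isFinal : ∀ (K : Type) (i : K) (w : Multiset (Sym O K)), ∀ r ∈ rules, ¬ r.Applicable i final w

open Classical in
/-- The initial configuration with general `g`: all cells are in the quiescent state and contain
(besides their cell ID) the reified count of their outdegree; the general also contains one copy of
the starting symbol. -/
noncomputable def Prototype.init {O Q K : Type} (P : Prototype O Q) (δ : K → K → Prop) (g : K) :
    Config O Q K :=
  fun i => (P.quiescent, Multiset.replicate (outdegree δ i) (.elem P.count) +
    if i = g then {.elem P.start} else 0)

/-- The evolution `ev` terminates with step `T`, and during this last step all cells enter the final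
state, simultaneously and for the first time. -/
def Prototype.FiresAt {O Q K : Type} (P : Prototype O Q) (ev : ℕ → Config O Q K) (T : ℕ) : Prop :=
  0 < T ∧ (∀ t < T, ∀ i, (ev t i).1 ≠ P.final) ∧ (∀ i, (ev T i).1 = P.final) ∧
    Halted P.rules (ev T)

end PSystem

namespace PSystem

/-! ## The applications of one rule -/

/-! The solution combines termination detection with a countdown whose length is a measured time.
Greetings spread from the general. A greeted cell turns each greeting into the fact that there is an
arc from the greeter to itself, and all facts are flooded. A child cannot answer along an arc, so a
cell learns about its children only when these facts travel around the digraph back to it. It knows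
that it has heard of all of them by comparing with its outdegree, and then it floods a "done" fact
about itself.

The rules have no negative tests; rule priority within one step replaces them. `childRule` takes one
copy of the counting symbol per distinct known child, a leftover copy makes `blockRule` absorb the
pulse, and only a surviving pulse becomes a done fact (`knowsChildren_of_done`, `done_mem_content`).
In the same way `asideRule` takes away the facts about done cells, a leftover fact advances the
clock, and only a clock that is left untouched ignites the countdown.

Correctness rests on the field `closed` of `Invariant`: whoever holds the done fact about a cell
also holds all arcs leaving that cell, because they are flooded together and never lost. If every
cell named in the general's facts is done (`Ready`), the named cells include the general and are
closed under taking children, hence are all cells. A fact naming a cell at time τ also certifies a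
walk of length less than τ from the general to it (`Exploring.exists_walk_lt`).

Let τ be the first positive time at which the general is ready; its clock then shows τ - 1. Every
copy of the countdown has value n at time t with n + t = 2τ, whichever way it travelled
(`Counting.step`). All copies thus reach 0 at time 2τ, by which time every cell holds one, and all
cells fire in step 2τ + 1. Three successive waves (greetings, arcs back to the parents, done facts
to the general) give τ ≤ e + 2D + 4 in `ready_of_le`. Nondeterminism is harmless: facts are used
only through membership, and every argument uses only the maximality of the applications. -/

theorem mem_sum_map {α β : Type} (s : Multiset α) (f : α → Multiset β) (x : β) :
    x ∈ (s.map f).sum ↔ ∃ g ∈ s, x ∈ f g :=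
  Multiset.mem_bind (s := s) (f := f)

/-- The rule `r`, applied by `apps`, leaves `u'` of the available symbols `u`. -/
structure Rule.Run {O Q K : Type} (r : Rule O Q) (i : K) (w u : Multiset (Sym O K))
    (apps : Multiset (Ground O K)) (u' : Multiset (Sym O K)) : Prop where
  isApplication : r.IsApplication i w u apps
  avail_eq : u = (apps.map Ground.consume).sum + u'

namespace Rule.Run

variable {O Q K : Type} {r : Rule O Q} {i : K} {w u u' : Multiset (Sym O K)}
  {apps : Multiset (Ground O K)}

theorem mem_instances (h : r.Run i w u apps u') {g : Ground O K} (hg : g ∈ apps) :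
    g ∈ r.instances i w :=
  h.isApplication.1.mem_instances g hg

theorem le (h : r.Run i w u apps u') : u' ≤ u := by
  rw [h.avail_eq]; exact Multiset.le_add_left _ _

theorem consume_le (h : r.Run i w u apps u') {g : Ground O K} (hg : g ∈ apps) : g.consume ≤ u :=
  (Multiset.le_sum_of_mem (Multiset.mem_map_of_mem _ hg)).trans h.isApplication.1.consume_le

theorem mem_or (h : r.Run i w u apps u') {x : Sym O K} (hx : x ∈ u) :
    x ∈ u' ∨ ∃ g ∈ apps, x ∈ g.consume := by
  rw [h.avail_eq, Multiset.mem_add, mem_sum_map] at hx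
  exact hx.symm

/-- This is maximality in usable form: the instance could be added to the applications. The last two
hypotheses are exactly what the two `min` modes require for that. -/
theorem false_of_consume_le (h : r.Run i w u apps u') {g : Ground O K}
    (hg : g ∈ r.instances i w) (hc : g.consume ≤ u') (hi : r.inst = .min → apps = 0)
    (hr : r.rew = .min → g ∉ apps) : False := by
  have ha := h.isApplication.1
  refine h.isApplication.2 g ⟨?_, ?_, ?_, ?_⟩
  · intro g' hg'
    rcases Multiset.mem_cons.1 hg' with rfl | hg'
    · exact hg
    · exact ha.mem_instances g' hg'
  · rw [Multiset.map_cons, Multiset.sum_cons, h.avail_eq, add_comm]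
    exact add_le_add_right hc _
  · intro hm
    rw [hi hm]
    simp
  · intro hm
    exact Multiset.nodup_cons.2 ⟨hr hm, ha.rew_min hm⟩

/-- A rule that consumes nothing is applied in all its instances. -/
theorem mem_apps (h : r.Run i w u apps u') (hi : r.inst = .max) {g : Ground O K}
    (hg : g ∈ r.instances i w) (hc : g.consume = 0) : g ∈ apps := by
  by_contra hn
  exact h.false_of_consume_le hg (hc ▸ Multiset.zero_le _) (by simp [hi]) fun _ => hn

/-- A rule with modes `max.max` uses up whatever it can consume. -/
theorem not_consume_le (h : r.Run i w u apps u') (hi : r.inst = .max) (hr : r.rew = .max)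
    {g : Ground O K} (hg : g ∈ r.instances i w) : ¬ g.consume ≤ u' := fun hc =>
  h.false_of_consume_le hg hc (by simp [hi]) (by simp [hr])

/-- With no application at all, nothing has been consumed, and one application is allowed in every
mode. -/
theorem exists_mem_apps (h : r.Run i w u apps u') {g : Ground O K}
    (hg : g ∈ r.instances i w) (hc : g.consume ≤ u) : ∃ g', g' ∈ apps := by
  by_contra! hn
  have h0 : apps = 0 := Multiset.eq_zero_of_forall_notMem hn
  have hu : u = u' := by simpa [h0] using h.avail_eq
  exact h.false_of_consume_le hg (hu ▸ hc) (fun _ => h0) fun _ => hn g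

/-- A rule with modes `min.min` is applied at most once. -/
theorem apps_eq_singleton (h : r.Run i w u apps u') (hi : r.inst = .min) (hr : r.rew = .min)
    {g : Ground O K} (hg : g ∈ apps) : apps = {g} := by
  have hn := h.isApplication.1.rew_min hr
  obtain ⟨s, rfl⟩ := Multiset.exists_cons_of_mem hg
  have : s = 0 := Multiset.eq_zero_of_forall_notMem fun g' hg' => by
    have := h.isApplication.1.inst_min hi g (by simp) g' (by simp [hg'])
    exact (Multiset.nodup_cons.1 hn).1 (this ▸ hg')
  simp [this]

end Rule.Run

/-! ## The course of a step -/

/-- A step of cell `i` in which all the rules of the list `rs` take part: `app k` are the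
applications of the `k`-th rule, and `avail k` the symbols available to it. -/
structure Trace {O Q K : Type} (rs : List (Rule O Q)) (i : K) (w : Multiset (Sym O K))
    (app : ℕ → Multiset (Ground O K)) (avail : ℕ → Multiset (Sym O K))
    (w' y : Multiset (Sym O K)) : Prop where
  avail_zero : avail 0 = w
  run : ∀ k (hk : k < rs.length), rs[k].Run i w (avail k) (app k) (avail (k + 1))
  content : w' = avail rs.length + ∑ k ∈ Finset.range rs.length, ((app k).map Ground.produce).sum
  sent : y = ∑ k ∈ Finset.range rs.length, ((app k).map Ground.send).sum

theorem Rule.Turn.exists_run {O Q K : Type} {r : Rule O Q} {i : K} {S : Q}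
    {w : Multiset (Sym O K)} {a b : Partial O Q K} (h : r.Turn i S w a b) (hs : r.source = S)
    (ha : ∀ T ∈ a.target, T = r.target) :
    ∃ apps, r.Run i w a.avail apps b.avail ∧ b.made = a.made + (apps.map Ground.produce).sum ∧
      b.sent = a.sent + (apps.map Ground.send).sum ∧
      (apps = 0 → b.target = a.target) ∧ (apps ≠ 0 → b.target = some r.target) := by
  rcases h with ⟨-, apps, h1, h2, h3, h4, h5, h6⟩ | ⟨h, -⟩
  · exact ⟨apps, ⟨h1, h2⟩, h3, h4, h5, h6⟩
  · exact (h ⟨hs, ha⟩).elim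

/-- As all targets agree, the target condition never excludes a rule, whichever rules were applied
before. So every rule makes a maximal run. -/
theorem Turns.exists_trace {O Q K : Type} {rs : List (Rule O Q)} {i : K} {S : Q}
    {w : Multiset (Sym O K)} {a b : Partial O Q K} (h : Turns i S w rs a b)
    (hrs : ∀ r ∈ rs, r.source = S ∧ r.target = S) (ha : ∀ T ∈ a.target, T = S) :
    (∀ T ∈ b.target, T = S) ∧ ∃ (app : ℕ → Multiset (Ground O K))
      (avail : ℕ → Multiset (Sym O K)), avail 0 = a.avail ∧
      (∀ k (hk : k < rs.length), rs[k].Run i w (avail k) (app k) (avail (k + 1))) ∧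
      b.avail = avail rs.length ∧
      b.made = a.made + ∑ k ∈ Finset.range rs.length, ((app k).map Ground.produce).sum ∧
      b.sent = a.sent + ∑ k ∈ Finset.range rs.length, ((app k).map Ground.send).sum := by
  induction rs generalizing a with
  | nil =>
    have h : b = a := h
    subst h
    exact ⟨ha, fun _ => 0, fun _ => b.avail, rfl, by simp, rfl, by simp, by simp⟩
  | cons r rs ih =>
    obtain ⟨c, hc, hb⟩ := h
    obtain ⟨hs, ht⟩ := hrs r (by simp)
    obtain ⟨apps, h1, h2, h3, h4, h5⟩ := hc.exists_run hs (by rwa [ht])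
    have hct : ∀ T ∈ c.target, T = S := by
      by_cases h0 : apps = 0
      · rwa [h4 h0]
      · rw [h5 h0, ht]
        simp
    obtain ⟨i1, app, avail, i2, i3, i4, i5, i6⟩ :=
      ih hb (fun r hr => hrs r (List.mem_cons_of_mem _ hr)) hct
    refine ⟨i1, fun k => k.casesOn apps app, fun k => k.casesOn a.avail avail, rfl, ?_, i4, ?_, ?_⟩
    · rintro (_ | k) hk
      · simpa [i2] using h1
      · exact i3 k (by simpa using hk)
    · rw [i5, h2, List.length_cons, Finset.sum_range_succ', add_assoc,
        add_comm (apps.map Ground.produce).sum]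
      rfl
    · rw [i6, h3, List.length_cons, Finset.sum_range_succ', add_assoc,
        add_comm (apps.map Ground.send).sum]
      rfl

namespace Trace

variable {O Q K : Type} {rs : List (Rule O Q)} {i : K} {w w' y : Multiset (Sym O K)}
  {app : ℕ → Multiset (Ground O K)} {avail : ℕ → Multiset (Sym O K)}

theorem avail_anti (h : Trace rs i w app avail w' y) {k m : ℕ} (hkm : k ≤ m)
    (hm : m ≤ rs.length) : avail m ≤ avail k := by
  induction m, hkm using Nat.le_induction with
  | base => exact le_rfl
  | succ m _ ih => exact (h.run m hm).le.trans (ih (by omega))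

theorem avail_le (h : Trace rs i w app avail w' y) {k : ℕ} (hk : k ≤ rs.length) :
    avail k ≤ w :=
  h.avail_zero ▸ h.avail_anti (Nat.zero_le k) hk

theorem mem_content (h : Trace rs i w app avail w' y) (x : Sym O K) :
    x ∈ w' ↔ x ∈ avail rs.length ∨ ∃ k, k < rs.length ∧ ∃ g ∈ app k, x ∈ g.produce := by
  simp [h.content, mem_sum_map]

theorem mem_sent (h : Trace rs i w app avail w' y) (x : Sym O K) :
    x ∈ y ↔ ∃ k, k < rs.length ∧ ∃ g ∈ app k, x ∈ g.send := by
  simp [h.sent, mem_sum_map]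

/-- What is used up has been consumed by some application. -/
theorem mem_avail_or (h : Trace rs i w app avail w' y) {x : Sym O K} (hx : x ∈ w) {n : ℕ}
    (hn : n ≤ rs.length) :
    x ∈ avail n ∨ ∃ k, ∃ _ : k < n, ∃ g ∈ app k, x ∈ g.consume := by
  induction n with
  | zero => exact Or.inl (h.avail_zero ▸ hx)
  | succ n ih =>
    rcases ih (by omega) with hx | ⟨k, hk, hg⟩
    · rcases (h.run n hn).mem_or hx with hx | hx
      · exact Or.inl hx
      · exact Or.inr ⟨n, by omega, hx⟩
    · exact Or.inr ⟨k, by omega, hg⟩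

/-- A symbol is still available if the rules so far cannot consume it. -/
theorem mem_avail (h : Trace rs i w app avail w' y) {x : Sym O K} (hx : x ∈ w) {n : ℕ}
    (hn : n ≤ rs.length)
    (hc : ∀ k (hk : k < rs.length), ∀ g ∈ rs[k].instances i w, k < n → x ∉ g.consume) :
    x ∈ avail n :=
  (h.mem_avail_or hx hn).resolve_right fun ⟨k, hk, g, hg, hx⟩ =>
    hc k (by omega) g ((h.run k (by omega)).mem_instances hg) hk hx

theorem count_avail [DecidableEq (Sym O K)] (h : Trace rs i w app avail w' y) {x : Sym O K}
    {n : ℕ} (hn : n ≤ rs.length)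
    (hc : ∀ k (hk : k < rs.length), ∀ g ∈ rs[k].instances i w, k < n → x ∉ g.consume) :
    (avail n).count x = w.count x := by
  induction n with
  | zero => rw [h.avail_zero]
  | succ n ih =>
    have hx : x ∉ ((app n).map Ground.consume).sum := by
      rw [mem_sum_map]
      rintro ⟨g, hg, hx⟩
      exact hc n hn g ((h.run n hn).mem_instances hg) (by omega) hx
    rw [← ih (by omega) fun k hk g hg hkn => hc k hk g hg (by omega), (h.run n hn).avail_eq,
      Multiset.count_add, Multiset.count_eq_zero_of_notMem hx, zero_add]

/-- A symbol is kept if every rule that consumes it produces it again. -/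
theorem mem_content_of_mem (h : Trace rs i w app avail w' y) {x : Sym O K} (hx : x ∈ w)
    (hc : ∀ k (hk : k < rs.length), ∀ g ∈ rs[k].instances i w, x ∈ g.consume → x ∈ g.produce) :
    x ∈ w' := by
  rw [h.mem_content]
  rcases h.mem_avail_or hx le_rfl with hx | ⟨k, hk, g, hg, hx⟩
  · exact Or.inl hx
  · exact Or.inr ⟨k, hk, g, hg, hc k hk g ((h.run k hk).mem_instances hg) hx⟩

theorem map_sum_map {M : Type} [AddCommMonoid M] (φ : Multiset (Sym O K) →+ M)
    (s : Multiset (Ground O K)) (f : Ground O K → Multiset (Sym O K)) :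
    φ (s.map f).sum = (s.map fun g => φ (f g)).sum := by
  rw [map_multiset_sum, Multiset.map_map]
  rfl

/-- An additive quantity is conserved if every rule conserves it. -/
theorem map_content (h : Trace rs i w app avail w' y) {M : Type} [AddCommMonoid M]
    (φ : Multiset (Sym O K) →+ M)
    (hφ : ∀ k (hk : k < rs.length), ∀ g ∈ rs[k].instances i w, φ g.produce = φ g.consume) :
    φ w' = φ w := by
  -- The loop invariant adds what is still available to what has been produced so far; each rule
  -- only moves the quantity from the first part to the second.
  have key : ∀ n ≤ rs.length,
      φ (avail n + ∑ k ∈ Finset.range n, ((app k).map Ground.produce).sum) = φ w := by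
    intro n
    induction n with
    | zero => simp [h.avail_zero]
    | succ n ih =>
      intro hn
      rw [← ih (by omega), Finset.sum_range_succ, map_add, map_add, map_add,
        (h.run n hn).avail_eq, map_add, map_sum_map, map_sum_map]
      have : (app n).map (fun g => φ g.produce) = (app n).map (fun g => φ g.consume) :=
        Multiset.map_congr rfl fun g hg => hφ n hn g ((h.run n hn).mem_instances hg)
      rw [this]
      abel
  rw [h.content]
  exact key _ le_rfl

end Trace

namespace FiringSquad

/-! ## The cell prototype -/

/-- The alphabet: `start` marks the general, `count` reifies the outdegree, `pulse` appears once in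
every step of an awake cell, `clock` carries the time of the general, `hello` goes to the children,
`fact` is flooded through the digraph, `done` occurs in the facts about the cells that have heard of
all their children, and `fire` carries the countdown. -/
inductive Letter : Type
  | start | count | pulse | clock | hello | fact | done | fire

inductive Phase : Type
  | active | fired

instance : Finite Letter :=
  Set.finite_univ_iff.1 ((Set.toFinite
    {.start, .count, .pulse, .clock, .hello, .fact, .done, .fire}).subset (by rintro (_ | _) <;> simp))

instance : Finite Phase :=
  Set.finite_univ_iff.1 ((Set.toFinite {.active, .fired}).subset (by rintro (_ | _) <;> simp))

section Symbols

variable {K : Type}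

abbrev startSym : Sym Letter K := .elem .start
abbrev countSym : Sym Letter K := .elem .count
abbrev pulseSym : Sym Letter K := .elem .pulse
abbrev doneSym : Sym Letter K := .elem .done
abbrev clockSym (n : ℕ) : Sym Letter K := .pair (.elem .clock) (.num n)
abbrev helloSym (v : Sym Letter K) : Sym Letter K := .pair (.elem .hello) v
abbrev factSym (x : Sym Letter K) : Sym Letter K := .pair (.elem .fact) x
abbrev fireSym (n : ℕ) : Sym Letter K := .pair (.elem .fire) (.num n)

/-- The fact that there is an arc from `u` to `v`, or, for `u = doneSym`, that `v` has heard of all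
its children. -/
abbrev arcSym (u v : Sym Letter K) : Sym Letter K := factSym (.pair u v)

end Symbols

section Patterns

variable {s n : ℕ}

abbrev clockPat (e : NumExp n) : Pat Letter s n := .pair (.elem .clock) (.num e)
abbrev helloPat (p : Pat Letter s n) : Pat Letter s n := .pair (.elem .hello) p
abbrev factPat (p : Pat Letter s n) : Pat Letter s n := .pair (.elem .fact) p
abbrev arcPat (p q : Pat Letter s n) : Pat Letter s n := factPat (.pair p q)
abbrev firePat (e : NumExp n) : Pat Letter s n := .pair (.elem .fire) (.num e)

end Patterns

/-- It has the highest priority: its application fixes the target state `fired`, so that all other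
rules are skipped in that step. -/
def endRule : Rule Letter Phase where
  source := .active
  target := .fired
  inst := .min
  rew := .min
  symVars := 0
  numVars := 0
  lhs := [firePat (.const 0)]
  rhs := []
  send := []
  promoter := []
  symVars_bound := fun v => v.elim0
  numVars_bound := fun v => v.elim0
  lhs_ne_nil := by simp

/-- The general starts its clock; it gets a virtual parent. -/
def startRule : Rule Letter Phase where
  source := .active
  target := .active
  inst := .max
  rew := .max
  symVars := 0
  numVars := 0
  lhs := [.elem .start]
  rhs := [clockPat (.const 0), helloPat (.elem .start), arcPat (.elem .start) .self]
  send := []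
  promoter := []
  symVars_bound := fun v => v.elim0
  numVars_bound := fun v => v.elim0
  lhs_ne_nil := by simp

/-- A cell that has been greeted greets its children, and produces its pulse. -/
def pulseRule : Rule Letter Phase where
  source := .active
  target := .active
  inst := .min
  rew := .min
  symVars := 1
  numVars := 0
  lhs := []
  rhs := [.elem .pulse]
  send := [helloPat .self]
  promoter := [helloPat (.var 0)]
  symVars_bound := fun v => ⟨_, List.mem_singleton_self _, Or.inr (Subsingleton.elim _ _)⟩
  numVars_bound := fun v => v.elim0
  lhs_ne_nil := by simp

/-- A greeting is turned into a fact. -/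
def arcRule : Rule Letter Phase where
  source := .active
  target := .active
  inst := .max
  rew := .min
  symVars := 1
  numVars := 0
  lhs := []
  rhs := [arcPat (.var 0) .self]
  send := []
  promoter := [helloPat (.var 0)]
  symVars_bound := fun v => ⟨_, List.mem_singleton_self _, Or.inr (Subsingleton.elim _ _)⟩
  numVars_bound := fun v => v.elim0
  lhs_ne_nil := by simp

/-- All facts are flooded. -/
def floodRule : Rule Letter Phase where
  source := .active
  target := .active
  inst := .max
  rew := .min
  symVars := 1
  numVars := 0
  lhs := []
  rhs := []
  send := [factPat (.var 0)]
  promoter := [factPat (.var 0)]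
  symVars_bound := fun v => ⟨_, List.mem_singleton_self _, Or.inr (Subsingleton.elim _ _)⟩
  numVars_bound := fun v => v.elim0
  lhs_ne_nil := by simp

/-- Each known child takes one copy of the counting symbol. -/
def childRule : Rule Letter Phase where
  source := .active
  target := .active
  inst := .max
  rew := .min
  symVars := 1
  numVars := 0
  lhs := [.elem .count]
  rhs := [.elem .count]
  send := []
  promoter := [arcPat .self (.var 0)]
  symVars_bound := fun v => ⟨arcPat .self (.var 0), by simp,
    Or.inr (Or.inr (Subsingleton.elim _ _))⟩
  numVars_bound := fun v => v.elim0
  lhs_ne_nil := by simp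

/-- A copy of the counting symbol that is left over absorbs the pulse. -/
def blockRule : Rule Letter Phase where
  source := .active
  target := .active
  inst := .min
  rew := .min
  symVars := 0
  numVars := 0
  lhs := [.elem .count, .elem .pulse]
  rhs := [.elem .count]
  send := []
  promoter := []
  symVars_bound := fun v => v.elim0
  numVars_bound := fun v => v.elim0
  lhs_ne_nil := by simp

/-- Otherwise, all children are known. -/
def doneRule : Rule Letter Phase where
  source := .active
  target := .active
  inst := .max
  rew := .max
  symVars := 0
  numVars := 0
  lhs := [.elem .pulse]
  rhs := [arcPat (.elem .done) .self]
  send := []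
  promoter := []
  symVars_bound := fun v => v.elim0
  numVars_bound := fun v => v.elim0
  lhs_ne_nil := by simp

/-- The facts about the cells that have heard of all their children are put aside. -/
def asideRule : Rule Letter Phase where
  source := .active
  target := .active
  inst := .max
  rew := .max
  symVars := 2
  numVars := 0
  lhs := [arcPat (.var 0) (.var 1)]
  rhs := [arcPat (.var 0) (.var 1)]
  send := []
  promoter := [arcPat (.elem .done) (.var 1)]
  symVars_bound := fun v => ⟨arcPat (.var 0) (.var 1), by simp, Or.inr (by
    fin_cases v
    · exact Or.inl rfl
    · exact Or.inr rfl)⟩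
  numVars_bound := fun v => v.elim0
  lhs_ne_nil := by simp

/-- While another fact is left over, the clock of the general goes on. -/
def clockRule : Rule Letter Phase where
  source := .active
  target := .active
  inst := .min
  rew := .min
  symVars := 2
  numVars := 1
  lhs := [arcPat (.var 0) (.var 1), clockPat (.var 0)]
  rhs := [arcPat (.var 0) (.var 1), clockPat (.add (.var 0) (.const 1))]
  send := []
  promoter := []
  symVars_bound := fun v => ⟨arcPat (.var 0) (.var 1), by simp, Or.inr (by
    fin_cases v
    · exact Or.inl rfl
    · exact Or.inr rfl)⟩
  numVars_bound := fun v => ⟨clockPat (.var 0), by simp, Or.inr (Subsingleton.elim _ _)⟩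
  lhs_ne_nil := by simp

/-- Otherwise, the general starts the countdown from the time it needed. -/
def igniteRule : Rule Letter Phase where
  source := .active
  target := .active
  inst := .max
  rew := .max
  symVars := 0
  numVars := 1
  lhs := [clockPat (.var 0)]
  rhs := [firePat (.var 0)]
  send := []
  promoter := []
  symVars_bound := fun v => v.elim0
  numVars_bound := fun v => ⟨clockPat (.var 0), by simp, Or.inr (Subsingleton.elim _ _)⟩
  lhs_ne_nil := by simp

/-- The countdown is flooded. -/
def countdownRule : Rule Letter Phase where
  source := .active
  target := .active
  inst := .max
  rew := .max
  symVars := 0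
  numVars := 1
  lhs := [firePat (.add (.var 0) (.const 1))]
  rhs := [firePat (.var 0)]
  send := [firePat (.var 0)]
  promoter := []
  symVars_bound := fun v => v.elim0
  numVars_bound := fun v => ⟨firePat (.add (.var 0) (.const 1)), by simp,
    Or.inr (Or.inl (Subsingleton.elim _ _))⟩
  lhs_ne_nil := by simp

def activeRules : List (Rule Letter Phase) :=
  [startRule, pulseRule, arcRule, floodRule, childRule, blockRule, doneRule, asideRule, clockRule,
    igniteRule, countdownRule]

/-! ## The instances of the rules -/

section Instances

variable {K : Type} {i : K} {w : Multiset (Sym Letter K)} {g : Ground Letter K}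

theorem mem_instances_endRule :
    g ∈ endRule.instances i w ↔ g = ⟨{fireSym 0}, 0, 0, 0⟩ := by
  constructor
  · rintro ⟨⟨σ, ν, rfl⟩, -⟩
    rfl
  · rintro rfl
    exact ⟨⟨Fin.elim0, Fin.elim0, rfl⟩, Multiset.zero_le _⟩

theorem mem_instances_startRule : g ∈ startRule.instances i w ↔
    g = ⟨{startSym}, {clockSym 0, helloSym startSym, arcSym startSym (.id i)}, 0, 0⟩ := by
  constructor
  · rintro ⟨⟨σ, ν, rfl⟩, -⟩
    rfl
  · rintro rfl
    exact ⟨⟨Fin.elim0, Fin.elim0, rfl⟩, Multiset.zero_le _⟩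

theorem mem_instances_pulseRule : g ∈ pulseRule.instances i w ↔
    ∃ v, helloSym v ∈ w ∧ g = ⟨0, {pulseSym}, {helloSym (.id i)}, {helloSym v}⟩ := by
  constructor
  · rintro ⟨⟨σ, ν, rfl⟩, h⟩
    exact ⟨σ (0 : Fin 1), Multiset.singleton_le.1 h, rfl⟩
  · rintro ⟨v, hv, rfl⟩
    exact ⟨⟨fun _ => v, Fin.elim0, rfl⟩, Multiset.singleton_le.2 hv⟩

theorem mem_instances_arcRule : g ∈ arcRule.instances i w ↔
    ∃ v, helloSym v ∈ w ∧ g = ⟨0, {arcSym v (.id i)}, 0, {helloSym v}⟩ := by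
  constructor
  · rintro ⟨⟨σ, ν, rfl⟩, h⟩
    exact ⟨σ (0 : Fin 1), Multiset.singleton_le.1 h, rfl⟩
  · rintro ⟨v, hv, rfl⟩
    exact ⟨⟨fun _ => v, Fin.elim0, rfl⟩, Multiset.singleton_le.2 hv⟩

theorem mem_instances_floodRule : g ∈ floodRule.instances i w ↔
    ∃ v, factSym v ∈ w ∧ g = ⟨0, 0, {factSym v}, {factSym v}⟩ := by
  constructor
  · rintro ⟨⟨σ, ν, rfl⟩, h⟩
    exact ⟨σ (0 : Fin 1), Multiset.singleton_le.1 h, rfl⟩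
  · rintro ⟨v, hv, rfl⟩
    exact ⟨⟨fun _ => v, Fin.elim0, rfl⟩, Multiset.singleton_le.2 hv⟩

theorem mem_instances_childRule : g ∈ childRule.instances i w ↔
    ∃ v, arcSym (.id i) v ∈ w ∧ g = ⟨{countSym}, {countSym}, 0, {arcSym (.id i) v}⟩ := by
  constructor
  · rintro ⟨⟨σ, ν, rfl⟩, h⟩
    exact ⟨σ (0 : Fin 1), Multiset.singleton_le.1 h, rfl⟩
  · rintro ⟨v, hv, rfl⟩
    exact ⟨⟨fun _ => v, Fin.elim0, rfl⟩, Multiset.singleton_le.2 hv⟩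

theorem mem_instances_blockRule : g ∈ blockRule.instances i w ↔
    g = ⟨{countSym, pulseSym}, {countSym}, 0, 0⟩ := by
  constructor
  · rintro ⟨⟨σ, ν, rfl⟩, -⟩
    rfl
  · rintro rfl
    exact ⟨⟨Fin.elim0, Fin.elim0, rfl⟩, Multiset.zero_le _⟩

theorem mem_instances_doneRule : g ∈ doneRule.instances i w ↔
    g = ⟨{pulseSym}, {arcSym doneSym (.id i)}, 0, 0⟩ := by
  constructor
  · rintro ⟨⟨σ, ν, rfl⟩, -⟩
    rfl
  · rintro rfl
    exact ⟨⟨Fin.elim0, Fin.elim0, rfl⟩, Multiset.zero_le _⟩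

theorem mem_instances_asideRule : g ∈ asideRule.instances i w ↔
    ∃ u v, arcSym doneSym v ∈ w ∧ g = ⟨{arcSym u v}, {arcSym u v}, 0, {arcSym doneSym v}⟩ := by
  constructor
  · rintro ⟨⟨σ, ν, rfl⟩, h⟩
    exact ⟨σ (0 : Fin 2), σ (1 : Fin 2), Multiset.singleton_le.1 h, rfl⟩
  · rintro ⟨u, v, hv, rfl⟩
    exact ⟨⟨![u, v], Fin.elim0, rfl⟩, Multiset.singleton_le.2 hv⟩

theorem mem_instances_clockRule : g ∈ clockRule.instances i w ↔
    ∃ u v n, g = ⟨{arcSym u v, clockSym n}, {arcSym u v, clockSym (n + 1)}, 0, 0⟩ := by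
  constructor
  · rintro ⟨⟨σ, ν, rfl⟩, h⟩
    exact ⟨σ (0 : Fin 2), σ (1 : Fin 2), ν (0 : Fin 1), rfl⟩
  · rintro ⟨u, v, n, rfl⟩
    exact ⟨⟨![u, v], fun _ => n, rfl⟩, Multiset.zero_le _⟩

theorem mem_instances_igniteRule : g ∈ igniteRule.instances i w ↔
    ∃ n, g = ⟨{clockSym n}, {fireSym n}, 0, 0⟩ := by
  constructor
  · rintro ⟨⟨σ, ν, rfl⟩, h⟩
    exact ⟨ν (0 : Fin 1), rfl⟩
  · rintro ⟨n, rfl⟩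
    exact ⟨⟨Fin.elim0, fun _ => n, rfl⟩, Multiset.zero_le _⟩

theorem mem_instances_countdownRule : g ∈ countdownRule.instances i w ↔
    ∃ n, g = ⟨{fireSym (n + 1)}, {fireSym n}, {fireSym n}, 0⟩ := by
  constructor
  · rintro ⟨⟨σ, ν, rfl⟩, h⟩
    exact ⟨ν (0 : Fin 1), rfl⟩
  · rintro ⟨n, rfl⟩
    exact ⟨⟨Fin.elim0, fun _ => n, rfl⟩, Multiset.zero_le _⟩

/-- A case distinction over the active rules and their instances. -/
theorem forall_instances {P : ℕ → Ground Letter K → Prop}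
    (h0 : P 0 ⟨{startSym}, {clockSym 0, helloSym startSym, arcSym startSym (.id i)}, 0, 0⟩)
    (h1 : ∀ v, helloSym v ∈ w → P 1 ⟨0, {pulseSym}, {helloSym (.id i)}, {helloSym v}⟩)
    (h2 : ∀ v, helloSym v ∈ w → P 2 ⟨0, {arcSym v (.id i)}, 0, {helloSym v}⟩)
    (h3 : ∀ v, factSym v ∈ w → P 3 ⟨0, 0, {factSym v}, {factSym v}⟩)
    (h4 : ∀ v, arcSym (.id i) v ∈ w →
      P 4 ⟨{countSym}, {countSym}, 0, {arcSym (.id i) v}⟩)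
    (h5 : P 5 ⟨{countSym, pulseSym}, {countSym}, 0, 0⟩)
    (h6 : P 6 ⟨{pulseSym}, {arcSym doneSym (.id i)}, 0, 0⟩)
    (h7 : ∀ u v, arcSym doneSym v ∈ w →
      P 7 ⟨{arcSym u v}, {arcSym u v}, 0, {arcSym doneSym v}⟩)
    (h8 : ∀ u v n, P 8 ⟨{arcSym u v, clockSym n}, {arcSym u v, clockSym (n + 1)}, 0, 0⟩)
    (h9 : ∀ n, P 9 ⟨{clockSym n}, {fireSym n}, 0, 0⟩)
    (h10 : ∀ n, P 10 ⟨{fireSym (n + 1)}, {fireSym n}, {fireSym n}, 0⟩)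
    (k : ℕ) (hk : k < activeRules.length) (g : Ground Letter K)
    (hg : g ∈ activeRules[k].instances i w) : P k g := by
  match k, hk, hg with
  | 0, _, hg => exact mem_instances_startRule.1 hg ▸ h0
  | 1, _, hg => obtain ⟨v, hv, rfl⟩ := mem_instances_pulseRule.1 hg; exact h1 v hv
  | 2, _, hg => obtain ⟨v, hv, rfl⟩ := mem_instances_arcRule.1 hg; exact h2 v hv
  | 3, _, hg => obtain ⟨v, hv, rfl⟩ := mem_instances_floodRule.1 hg; exact h3 v hv
  | 4, _, hg => obtain ⟨v, hv, rfl⟩ := mem_instances_childRule.1 hg; exact h4 v hv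
  | 5, _, hg => exact mem_instances_blockRule.1 hg ▸ h5
  | 6, _, hg => exact mem_instances_doneRule.1 hg ▸ h6
  | 7, _, hg => obtain ⟨u, v, hv, rfl⟩ := mem_instances_asideRule.1 hg; exact h7 u v hv
  | 8, _, hg => obtain ⟨u, v, n, rfl⟩ := mem_instances_clockRule.1 hg; exact h8 u v n
  | 9, _, hg => obtain ⟨n, rfl⟩ := mem_instances_igniteRule.1 hg; exact h9 n
  | 10, _, hg => obtain ⟨n, rfl⟩ := mem_instances_countdownRule.1 hg; exact h10 n
  | k + 11, hk, _ => exact absurd hk (by simp [activeRules])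

end Instances

def prototype : Prototype Letter Phase where
  rules := endRule :: activeRules
  quiescent := .active
  final := .fired
  count := .count
  start := .start
  quiescent_ne_final := by simp
  count_ne_start := by simp
  isQuiescent := by
    rintro K i d r hr ⟨-, g, hg, hc⟩
    have hw : ∀ x ∈ Multiset.replicate d (Sym.elem Letter.count : Sym Letter K), x = countSym :=
      fun x => Multiset.eq_of_mem_replicate
    rcases List.mem_cons.1 hr with rfl | hr
    · rw [mem_instances_endRule] at hg
      subst hg
      simpa using hw (fireSym 0) (Multiset.mem_of_le hc (by simp))
    · obtain ⟨k, hk, rfl⟩ := List.mem_iff_getElem.1 hr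
      revert hc
      -- Every instance consumes, or has as a promoter, some symbol other than `countSym`.
      refine forall_instances (i := i) (w := Multiset.replicate d countSym)
        (P := fun _ g => ¬ g.consume ≤ Multiset.replicate d countSym)
        ?_ ?_ ?_ ?_ ?_ ?_ ?_ ?_ ?_ ?_ ?_ k hk g hg
      · intro hc
        simpa using hw startSym (Multiset.mem_of_le hc (by simp))
      · intro v hv
        simpa using hw _ hv
      · intro v hv
        simpa using hw _ hv
      · intro v hv
        simpa using hw _ hv
      · intro v hv
        simpa using hw _ hv
      · intro hc
        simpa using hw pulseSym (Multiset.mem_of_le hc (by simp))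
      · intro hc
        simpa using hw pulseSym (Multiset.mem_of_le hc (by simp))
      · intro u v hv
        simpa using hw _ hv
      · intro u v n hc
        simpa using hw (clockSym n) (Multiset.mem_of_le hc (by simp))
      · intro n hc
        simpa using hw (clockSym n) (Multiset.mem_of_le hc (by simp))
      · intro n hc
        simpa using hw (fireSym (n + 1)) (Multiset.mem_of_le hc (by simp))
  isFinal := by
    rintro K i w r hr ⟨hs, -⟩
    have : ∀ r ∈ endRule :: activeRules, r.source = .active := by
      simp [activeRules, endRule, startRule, pulseRule, arcRule, floodRule, childRule, blockRule,
        doneRule, asideRule, clockRule, igniteRule, countdownRule]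
    rw [this r hr] at hs
    cases hs

/-! ## The steps of an active cell -/

section Cell

variable {K : Type} {i : K} {w w' y : Multiset (Sym Letter K)}

theorem turns_eq_of_target {rs : List (Rule Letter Phase)} {S T : Phase}
    {a b : Partial Letter Phase K} (h : Turns i S w rs a b) (ha : a.target = some T)
    (hrs : ∀ r ∈ rs, r.target ≠ T) : b = a := by
  induction rs with
  | nil => exact h
  | cons r rs ih =>
    obtain ⟨c, hc, hb⟩ := h
    have : c = a := by
      rcases hc with ⟨⟨-, h2⟩, -⟩ | ⟨-, h⟩
      · exact (hrs r (by simp) (h2 T (by simp [ha])).symm).elim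
      · exact h
    subst this
    exact ih hb fun r hr => hrs r (List.mem_cons_of_mem _ hr)

theorem activeRules_source_target : ∀ r ∈ activeRules, r.source = .active ∧ r.target = .active := by
  simp [activeRules, startRule, pulseRule, arcRule, floodRule, childRule, blockRule,
    doneRule, asideRule, clockRule, igniteRule, countdownRule]

theorem state_eq_fired {S : Phase} (h : CellStep prototype.rules i .active w S w' y)
    (h0 : fireSym 0 ∈ w) : S = .fired := by
  obtain ⟨b, ⟨c, hc, hb⟩, rfl, -, -⟩ := h
  obtain ⟨apps, h1, -, -, -, h5⟩ := hc.exists_run rfl (by simp)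
  obtain ⟨g, hg⟩ := h1.exists_mem_apps (mem_instances_endRule.2 rfl) (Multiset.singleton_le.2 h0)
  have hct : c.target = some .fired := h5 (by rintro rfl; simp at hg)
  rw [turns_eq_of_target hb hct fun r hr => by simp [(activeRules_source_target r hr).2], hct]
  rfl

/-- Without `fireSym 0` the first rule has no application, so no target is fixed when the active
rules begin. -/
theorem exists_trace {S : Phase} (h : CellStep prototype.rules i .active w S w' y)
    (h0 : fireSym 0 ∉ w) :
    S = .active ∧ ∃ app avail, Trace activeRules i w app avail w' y := by
  obtain ⟨b, ⟨c, hc, hb⟩, rfl, rfl, rfl⟩ := h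
  obtain ⟨apps, h1, h2, h3, h4, -⟩ := hc.exists_run rfl (by simp)
  have hA : apps = 0 := Multiset.eq_zero_of_forall_notMem fun g hg => by
    have := h1.consume_le hg
    rw [mem_instances_endRule.1 (h1.mem_instances hg)] at this
    exact h0 (Multiset.singleton_le.1 this)
  have hct := h4 hA
  have hca := h1.avail_eq
  simp only [hA, Multiset.map_zero, Multiset.sum_zero, add_zero, zero_add] at h2 h3 hca
  obtain ⟨hT, app, avail, t1, t2, t3, t4, t5⟩ :=
    Turns.exists_trace hb activeRules_source_target (by simp [hct])
  refine ⟨?_, app, avail, t1.trans hca.symm, t2, ?_, ?_⟩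
  · cases hbt : b.target with
    | none => rfl
    | some T => exact hT T (by simp [hbt])
  · rw [t3, t4, h2, zero_add]
  · rw [t5, h3, zero_add]

variable {app : ℕ → Multiset (Ground Letter K)} {avail : ℕ → Multiset (Sym Letter K)}

/-- Membership in `app k` is passed on to the cases, since for some rules it is the very fact of
their application, despite their low priority, that carries the information. -/
theorem content_cases (h : Trace activeRules i w app avail w' y) {x : Sym Letter K} (hx : x ∈ w')
    {P : Prop} (h1 : x ∈ avail 11 → P)
    (h2 : ∀ k (hk : k < activeRules.length), ∀ g ∈ activeRules[k].instances i w,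
      g ∈ app k → g.consume ≤ w → x ∈ g.produce → P) : P := by
  rcases (h.mem_content x).1 hx with hx | ⟨k, hk, g, hg, hx⟩
  · exact h1 hx
  · exact h2 k hk g ((h.run k hk).mem_instances hg) hg
      (((h.run k hk).consume_le hg).trans (h.avail_le hk.le)) hx

theorem sent_cases (h : Trace activeRules i w app avail w' y) {x : Sym Letter K} (hx : x ∈ y)
    {P : Prop} (h2 : ∀ k (hk : k < activeRules.length), ∀ g ∈ activeRules[k].instances i w,
      g.consume ≤ w → x ∈ g.send → P) : P := by
  obtain ⟨k, hk, g, hg, hx⟩ := (h.mem_sent x).1 hx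
  exact h2 k hk g ((h.run k hk).mem_instances hg)
      (((h.run k hk).consume_le hg).trans (h.avail_le hk.le)) hx

/-! ### Persistent symbols and conserved counts -/

theorem fact_mem_content (h : Trace activeRules i w app avail w' y) {x : Sym Letter K}
    (hx : factSym x ∈ w) : factSym x ∈ w' := by
  refine h.mem_content_of_mem hx (forall_instances
    (P := fun _ g => factSym x ∈ g.consume → factSym x ∈ g.produce) ?_ ?_ ?_ ?_ ?_ ?_ ?_ ?_ ?_ ?_ ?_)
  all_goals simp

theorem hello_mem_content (h : Trace activeRules i w app avail w' y) {x : Sym Letter K}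
    (hx : helloSym x ∈ w) : helloSym x ∈ w' := by
  refine h.mem_content_of_mem hx (forall_instances (P := fun _ g =>
    helloSym x ∈ g.consume → helloSym x ∈ g.produce) ?_ ?_ ?_ ?_ ?_ ?_ ?_ ?_ ?_ ?_ ?_)
  all_goals simp

open Classical in
theorem count_content (h : Trace activeRules i w app avail w' y) :
    w'.count countSym = w.count countSym := by
  refine h.map_content (Multiset.countAddMonoidHom countSym) (forall_instances (P := fun _ g =>
    g.produce.count countSym = g.consume.count countSym) ?_ ?_ ?_ ?_ ?_ ?_ ?_ ?_ ?_ ?_ ?_)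
  all_goals simp

/-- The symbols of which the general has one copy. -/
def IsTimer (x : Sym Letter K) : Prop :=
  x = startSym ∨ (∃ n, x = clockSym n) ∨ ∃ n, x = fireSym n

open Classical in
-- The start symbol becomes a clock and the clock becomes a countdown, always one for one. Copies
-- sent to the children are not part of `w'`.
theorem timer_content (h : Trace activeRules i w app avail w' y) :
    w'.countP IsTimer = w.countP IsTimer := by
  refine h.map_content (Multiset.countPAddMonoidHom IsTimer) (forall_instances (P := fun _ g =>
    g.produce.countP IsTimer = g.consume.countP IsTimer) ?_ ?_ ?_ ?_ ?_ ?_ ?_ ?_ ?_ ?_ ?_)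
  all_goals simp [IsTimer, Multiset.countP_cons, ← Multiset.cons_zero]

/-! ### Greetings and facts -/

/-- The modes `min.min` make a single application, however many greetings are present. This keeps
the pulse unique. -/
theorem pulse_run (h : Trace activeRules i w app avail w' y) {v : Sym Letter K}
    (hv : helloSym v ∈ w) : ∃ v, app 1 = {⟨0, {pulseSym}, {helloSym (.id i)}, {helloSym v}⟩} := by
  have hr : pulseRule.Run i w (avail 1) (app 1) (avail 2) := h.run 1 (by decide)
  obtain ⟨g, hg⟩ := hr.exists_mem_apps (mem_instances_pulseRule.2 ⟨v, hv, rfl⟩)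
    (Multiset.zero_le _)
  obtain ⟨v, -, rfl⟩ := mem_instances_pulseRule.1 (hr.mem_instances hg)
  exact ⟨v, hr.apps_eq_singleton rfl rfl hg⟩

theorem pulse_mem_content (h : Trace activeRules i w app avail w' y) {v : Sym Letter K}
    (hv : helloSym v ∈ w) : pulseSym ∈ w' := by
  obtain ⟨v, hv⟩ := pulse_run h hv
  exact (h.mem_content _).2 (Or.inr ⟨1, by decide, _, hv ▸ Multiset.mem_singleton_self _,
    Multiset.mem_singleton_self _⟩)

theorem hello_mem_sent (h : Trace activeRules i w app avail w' y) {v : Sym Letter K}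
    (hv : helloSym v ∈ w) : helloSym (.id i) ∈ y := by
  obtain ⟨v, hv⟩ := pulse_run h hv
  exact (h.mem_sent _).2 ⟨1, by decide, _, hv ▸ Multiset.mem_singleton_self _,
    Multiset.mem_singleton_self _⟩

theorem arc_mem_content (h : Trace activeRules i w app avail w' y) {v : Sym Letter K}
    (hv : helloSym v ∈ w) : arcSym v (.id i) ∈ w' := by
  have hr : arcRule.Run i w (avail 2) (app 2) (avail 3) := h.run 2 (by decide)
  exact (h.mem_content _).2 (Or.inr ⟨2, by decide, _,
    hr.mem_apps rfl (mem_instances_arcRule.2 ⟨v, hv, rfl⟩) rfl, by simp⟩)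

theorem fact_mem_sent (h : Trace activeRules i w app avail w' y) {x : Sym Letter K}
    (hx : factSym x ∈ w) : factSym x ∈ y := by
  have hr : floodRule.Run i w (avail 3) (app 3) (avail 4) := h.run 3 (by decide)
  exact (h.mem_sent _).2 ⟨3, by decide, _,
    hr.mem_apps rfl (mem_instances_floodRule.2 ⟨x, hx, rfl⟩) rfl, by simp⟩

theorem start_mem_content (h : Trace activeRules i w app avail w' y) (hs : startSym ∈ w) :
    clockSym 0 ∈ w' ∧ helloSym startSym ∈ w' ∧ arcSym startSym (.id i) ∈ w' := by
  have hr : startRule.Run i w (avail 0) (app 0) (avail 1) := h.run 0 (by decide)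
  obtain ⟨g, hg⟩ := hr.exists_mem_apps (mem_instances_startRule.2 rfl)
    (Multiset.singleton_le.2 (h.avail_zero ▸ hs))
  have hi := mem_instances_startRule.1 (hr.mem_instances hg)
  subst hi
  have key : ∀ x, x ∈ ({clockSym 0, helloSym startSym, arcSym startSym (.id i)} :
      Multiset (Sym Letter K)) → x ∈ w' :=
    fun x hx => (h.mem_content _).2 (Or.inr ⟨0, by decide, _, hg, hx⟩)
  exact ⟨key _ (by simp), key _ (by simp), key _ (by simp)⟩

theorem start_notMem_content (h : Trace activeRules i w app avail w' y) : startSym ∉ w' := by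
  intro hx
  refine content_cases h hx (fun hx => ?_) (forall_instances (P := fun k g => g ∈ app k →
    g.consume ≤ w → startSym ∈ g.produce → False) ?_ ?_ ?_ ?_ ?_ ?_ ?_ ?_ ?_ ?_ ?_)
  · have hr : startRule.Run i w (avail 0) (app 0) (avail 1) := h.run 0 (by decide)
    exact hr.not_consume_le rfl rfl (mem_instances_startRule.2 rfl) (Multiset.singleton_le.2
      (Multiset.mem_of_le (h.avail_anti (by decide) (by decide)) hx))
  all_goals simp

theorem hello_cases (h : Trace activeRules i w app avail w' y) {x : Sym Letter K}
    (hx : helloSym x ∈ w') : helloSym x ∈ w ∨ startSym ∈ w ∧ x = startSym := by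
  refine content_cases h hx (fun hx => Or.inl (Multiset.mem_of_le (h.avail_le (by decide)) hx))
    (forall_instances (P := fun k g => g ∈ app k → g.consume ≤ w → helloSym x ∈ g.produce →
      helloSym x ∈ w ∨ startSym ∈ w ∧ x = startSym) ?_ ?_ ?_ ?_ ?_ ?_ ?_ ?_ ?_ ?_ ?_)
  all_goals simp +contextual

theorem hello_sent_cases (h : Trace activeRules i w app avail w' y) {x : Sym Letter K}
    (hx : helloSym x ∈ y) : (∃ v, helloSym v ∈ w) ∧ x = .id i := by
  refine sent_cases h hx (forall_instances (P := fun k g => g.consume ≤ w → helloSym x ∈ g.send →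
      (∃ v, helloSym v ∈ w) ∧ x = .id i) ?_ ?_ ?_ ?_ ?_ ?_ ?_ ?_ ?_ ?_ ?_)
  case refine_2 => exact fun v hv _ hx => ⟨⟨v, hv⟩, by simpa using hx⟩
  all_goals simp

theorem fact_sent_cases (h : Trace activeRules i w app avail w' y) {x : Sym Letter K}
    (hx : factSym x ∈ y) : factSym x ∈ w := by
  refine sent_cases h hx (forall_instances (P := fun k g => g.consume ≤ w → factSym x ∈ g.send →
    factSym x ∈ w) ?_ ?_ ?_ ?_ ?_ ?_ ?_ ?_ ?_ ?_ ?_)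
  all_goals simp +contextual

theorem fire_sent_cases (h : Trace activeRules i w app avail w' y) {n : ℕ}
    (hx : fireSym n ∈ y) : fireSym (n + 1) ∈ w := by
  refine sent_cases h hx (forall_instances (P := fun k g => g.consume ≤ w → fireSym n ∈ g.send →
    fireSym (n + 1) ∈ w) ?_ ?_ ?_ ?_ ?_ ?_ ?_ ?_ ?_ ?_ ?_)
  all_goals simp +contextual

theorem elem_notMem_sent (h : Trace activeRules i w app avail w' y) (l : Letter) :
    Sym.elem l ∉ y := by
  intro hx
  refine sent_cases h hx (forall_instances (P := fun k g => g.consume ≤ w →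
    Sym.elem l ∈ g.send → False) ?_ ?_ ?_ ?_ ?_ ?_ ?_ ?_ ?_ ?_ ?_)
  all_goals simp

theorem clock_notMem_sent (h : Trace activeRules i w app avail w' y) (n : ℕ) :
    clockSym n ∉ y := by
  intro hx
  refine sent_cases h hx (forall_instances (P := fun k g => g.consume ≤ w →
    clockSym n ∈ g.send → False) ?_ ?_ ?_ ?_ ?_ ?_ ?_ ?_ ?_ ?_ ?_)
  all_goals simp

/-! ### Counting the children -/

open Classical in
/-- Cell `i` has heard of as many children as it has copies of the counting symbol. -/
def KnowsChildren (i : K) (w : Multiset (Sym Letter K)) : Prop :=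
  ∃ V : Finset (Sym Letter K), w.count countSym ≤ V.card ∧ ∀ v ∈ V, arcSym (.id i) v ∈ w

open Classical in
-- Each application of `childRule` takes one copy. The copy that it puts back is invisible until the
-- next step, so `avail 5` shows the true surplus.
theorem count_eq_card_add (h : Trace activeRules i w app avail w' y) :
    w.count countSym = (app 4).card + (avail 5).count countSym := by
  have hr : childRule.Run i w (avail 4) (app 4) (avail 5) := h.run 4 (by decide)
  have h4 : (avail 4).count countSym = w.count countSym := by
    refine h.count_avail (by decide) (forall_instances (P := fun k g => k < 4 →
      countSym ∉ g.consume) ?_ ?_ ?_ ?_ ?_ ?_ ?_ ?_ ?_ ?_ ?_)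
    all_goals simp
  have hs : (((app 4).map Ground.consume).sum).count countSym = (app 4).card := by
    have hone : (app 4).map (fun g => g.consume.count countSym) = (app 4).map fun _ => 1 :=
      Multiset.map_congr rfl fun g hg => by
        obtain ⟨v, -, rfl⟩ := mem_instances_childRule.1 (hr.mem_instances hg)
        simp
    have := Trace.map_sum_map (Multiset.countAddMonoidHom (countSym : Sym Letter K)) (app 4)
      Ground.consume
    simpa [hone] using this
  rw [← h4, hr.avail_eq, Multiset.count_add, hs]

open Classical in
-- `doneRule` uses up every old pulse that was not absorbed, so only the new one from `pulseRule`
-- can remain.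
theorem pulse_count_content_le (h : Trace activeRules i w app avail w' y) :
    w'.count pulseSym ≤ 1 := by
  have r1 : pulseRule.Run i w (avail 1) (app 1) (avail 2) := h.run 1 (by decide)
  have r6 : doneRule.Run i w (avail 6) (app 6) (avail 7) := h.run 6 (by decide)
  have hlast : pulseSym ∉ avail activeRules.length := fun hx =>
    r6.not_consume_le rfl rfl (mem_instances_doneRule.2 rfl) (Multiset.singleton_le.2
      (Multiset.mem_of_le (h.avail_anti (by decide) le_rfl) hx))
  have hother : ∀ k ∈ Finset.range activeRules.length, k ≠ 1 →
      (((app k).map Ground.produce).sum).count pulseSym = 0 := by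
    intro k hk hk1
    rw [Finset.mem_range] at hk
    refine Multiset.count_eq_zero_of_notMem fun hx => ?_
    obtain ⟨g, hg, hx⟩ := (mem_sum_map _ _ _).1 hx
    refine forall_instances (P := fun k g => k ≠ 1 → pulseSym ∉ g.produce)
      ?_ ?_ ?_ ?_ ?_ ?_ ?_ ?_ ?_ ?_ ?_ k hk g ((h.run k hk).mem_instances hg) hk1 hx
    all_goals simp
  rw [h.content, Multiset.count_add, Multiset.count_eq_zero_of_notMem hlast, zero_add,
    Multiset.count_sum', Finset.sum_eq_single_of_mem 1 (by decide) hother]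
  rcases Multiset.empty_or_exists_mem (app 1) with h0 | ⟨g, hg⟩
  · simp [h0]
  · obtain ⟨v, -, rfl⟩ := mem_instances_pulseRule.1 (r1.mem_instances hg)
    simp [r1.apps_eq_singleton rfl rfl hg]

theorem pulse_cases (h : Trace activeRules i w app avail w' y) (hx : pulseSym ∈ w') :
    pulseSym ∈ w ∨ ∃ v, helloSym v ∈ w := by
  refine content_cases h hx (fun hx => Or.inl (Multiset.mem_of_le (h.avail_le (by decide)) hx))
    (forall_instances (P := fun k g => g ∈ app k → g.consume ≤ w → pulseSym ∈ g.produce →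
      pulseSym ∈ w ∨ ∃ v, helloSym v ∈ w) ?_ ?_ ?_ ?_ ?_ ?_ ?_ ?_ ?_ ?_ ?_)
  case refine_2 => exact fun v hv _ _ _ => Or.inr ⟨v, hv⟩
  all_goals simp

open Classical in
-- The bound on the pulses is essential: `blockRule` absorbs only one, so a second pulse could yield
-- a false done fact.
theorem knowsChildren_of_done (h : Trace activeRules i w app avail w' y)
    (hp : w.count pulseSym ≤ 1) {g : Ground Letter K} (hg : g ∈ app 6) :
    pulseSym ∈ w ∧ KnowsChildren i w := by
  have r4 : childRule.Run i w (avail 4) (app 4) (avail 5) := h.run 4 (by decide)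
  have r5 : blockRule.Run i w (avail 5) (app 5) (avail 6) := h.run 5 (by decide)
  have r6 : doneRule.Run i w (avail 6) (app 6) (avail 7) := h.run 6 (by decide)
  have hp6 : pulseSym ∈ avail 6 := by
    have := r6.consume_le hg
    rw [mem_instances_doneRule.1 (r6.mem_instances hg)] at this
    exact Multiset.singleton_le.1 this
  -- A leftover count would make `blockRule` absorb one pulse, while another is still there for
  -- `doneRule`; that makes two.
  have hc5 : countSym ∉ avail 5 := by
    intro hc
    have hle : ({countSym, pulseSym} : Multiset (Sym Letter K)) ≤ avail 5 := by
      rw [Multiset.le_iff_subset (by simp)]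
      intro x hx
      rcases (by simpa using hx : x = countSym ∨ x = pulseSym) with rfl | rfl
      · exact hc
      · exact Multiset.mem_of_le r5.le hp6
    obtain ⟨g', hg'⟩ := r5.exists_mem_apps (mem_instances_blockRule.2 rfl) hle
    have hi := mem_instances_blockRule.1 (r5.mem_instances hg')
    have h5 := r5.avail_eq
    rw [r5.apps_eq_singleton rfl rfl hg', hi] at h5
    have h5' := congrArg (Multiset.count pulseSym) h5
    have := Multiset.count_le_of_le pulseSym (h.avail_le (k := 5) (by decide))
    have := Multiset.one_le_count_iff_mem.2 hp6
    simp at h5'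
    omega
  have hcard := count_eq_card_add h
  rw [Multiset.count_eq_zero_of_notMem hc5, add_zero] at hcard
  have hex : ∀ g ∈ app 4, ∃ v, arcSym (.id i) v ∈ w ∧
      g = ⟨{countSym}, {countSym}, 0, {arcSym (.id i) v}⟩ := fun g hg =>
    mem_instances_childRule.1 (r4.mem_instances hg)
  have : Nonempty (Sym Letter K) := ⟨countSym⟩
  choose! f hf hgf using hex
  -- The witness consists of the children named by the applications of `childRule`. Rewriting mode
  -- `min` makes these applications distinct, so duplicate copies of a fact are not counted twice.
  refine ⟨Multiset.mem_of_le (h.avail_le (by decide)) hp6, (app 4).toFinset.image f, ?_, ?_⟩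
  · rw [Finset.card_image_of_injOn, Multiset.toFinset_card_of_nodup
      (r4.isApplication.1.rew_min rfl), hcard]
    intro a ha b hb hab
    rw [hgf a (by simpa using ha), hgf b (by simpa using hb), hab]
  · intro v hv
    obtain ⟨a, ha, rfl⟩ := Finset.mem_image.1 hv
    exact hf a (by simpa using ha)

theorem done_mem_content (h : Trace activeRules i w app avail w' y) (hp : pulseSym ∈ w)
    (hk : KnowsChildren i w) : arcSym doneSym (.id i) ∈ w' := by
  classical
  have r4 : childRule.Run i w (avail 4) (app 4) (avail 5) := h.run 4 (by decide)
  have r5 : blockRule.Run i w (avail 5) (app 5) (avail 6) := h.run 5 (by decide)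
  have r6 : doneRule.Run i w (avail 6) (app 6) (avail 7) := h.run 6 (by decide)
  obtain ⟨V, hV, hVw⟩ := hk
  have hc5 : countSym ∉ avail 5 := by
    intro hc
    -- If a count were left, maximality would force one application for each member of `V`, which
    -- would already exhaust the counts.
    have hall : ∀ v ∈ V, (⟨{countSym}, {countSym}, 0, {arcSym (.id i) v}⟩ : Ground Letter K) ∈
        (app 4).toFinset := by
      intro v hv
      rw [Multiset.mem_toFinset]
      by_contra hn
      exact r4.false_of_consume_le (mem_instances_childRule.2 ⟨v, hVw v hv, rfl⟩)
        (Multiset.singleton_le.2 hc) (by simp [childRule]) fun _ => hn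
    have hle := Finset.card_le_card_of_injOn _ hall (by
      intro a _ b _ hab
      simpa using hab)
    have hle' := Multiset.toFinset_card_le (app 4)
    have := count_eq_card_add h
    have := Multiset.one_le_count_iff_mem.2 hc
    omega
  have hp5 : pulseSym ∈ avail 5 := by
    refine h.mem_avail hp (by decide) (forall_instances (P := fun k g => k < 5 →
      pulseSym ∉ g.consume) ?_ ?_ ?_ ?_ ?_ ?_ ?_ ?_ ?_ ?_ ?_)
    all_goals simp
  have hp6 : pulseSym ∈ avail 6 := by
    refine (r5.mem_or hp5).resolve_right ?_
    rintro ⟨g, hg, -⟩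
    have := r5.consume_le hg
    rw [mem_instances_blockRule.1 (r5.mem_instances hg)] at this
    exact hc5 (Multiset.mem_of_le this (by simp))
  obtain ⟨g, hg⟩ := r6.exists_mem_apps (mem_instances_doneRule.2 rfl) (Multiset.singleton_le.2 hp6)
  have hi := mem_instances_doneRule.1 (r6.mem_instances hg)
  exact (h.mem_content _).2 (Or.inr ⟨6, by decide, g, hg, by simp [hi]⟩)

open Classical in
-- `asideRule` and `clockRule` merely return what they consume, so new facts come only from the
-- start, from greetings and from `doneRule`.
theorem fact_cases (h : Trace activeRules i w app avail w' y)
    (hp : w.count pulseSym ≤ 1) {x : Sym Letter K} (hx : factSym x ∈ w') :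
    factSym x ∈ w ∨ (startSym ∈ w ∧ x = .pair startSym (.id i)) ∨
      (∃ v, helloSym v ∈ w ∧ x = .pair v (.id i)) ∨
      (x = .pair doneSym (.id i) ∧ pulseSym ∈ w ∧ KnowsChildren i w) := by
  refine content_cases h hx (fun hx => Or.inl (Multiset.mem_of_le (h.avail_le (by decide)) hx))
    (forall_instances (P := fun k g => g ∈ app k → g.consume ≤ w → factSym x ∈ g.produce →
      factSym x ∈ w ∨ (startSym ∈ w ∧ x = .pair startSym (.id i)) ∨
      (∃ v, helloSym v ∈ w ∧ x = .pair v (.id i)) ∨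
      (x = .pair doneSym (.id i) ∧ pulseSym ∈ w ∧ KnowsChildren i w))
    ?_ ?_ ?_ ?_ ?_ ?_ ?_ ?_ ?_ ?_ ?_)
  case refine_1 => simp +contextual
  case refine_3 => exact fun v hv _ _ hx => Or.inr (Or.inr (Or.inl ⟨v, hv, by simpa using hx⟩))
  case refine_7 => exact fun hg _ hx => Or.inr (Or.inr (Or.inr ⟨by simpa using hx,
    knowsChildren_of_done h hp hg⟩))
  case refine_8 =>
    intro u v _ _ hc hx
    obtain rfl : x = .pair u v := by simpa using hx
    exact Or.inl (Multiset.singleton_le.1 hc)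
  case refine_9 =>
    intro u v n _ hc hx
    obtain rfl : x = .pair u v := by simpa using hx
    exact Or.inl (Multiset.mem_of_le hc (by simp))
  all_goals simp

/-! ### The clock and the countdown -/

/-- All cells that occur in the facts have heard of all their children. -/
def Ready (w : Multiset (Sym Letter K)) : Prop :=
  ∀ u v, arcSym u v ∈ w → arcSym doneSym v ∈ w

/-- Among the rules before `clockRule`, only `asideRule` consumes facts, and it needs the missing
done fact as a promoter. -/
theorem arc_mem_avail (h : Trace activeRules i w app avail w' y) {u v : Sym Letter K}
    (hu : arcSym u v ∈ w) (hv : arcSym doneSym v ∉ w) : arcSym u v ∈ avail 8 := by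
  refine h.mem_avail hu (by decide) (forall_instances (P := fun k g => k < 8 →
    arcSym u v ∉ g.consume) ?_ ?_ ?_ ?_ ?_ ?_ ?_ ?_ ?_ ?_ ?_)
  case refine_8 =>
    intro u' v' hv' _ hx
    obtain ⟨rfl, rfl⟩ : u = u' ∧ v = v' := by simpa using hx
    exact hv hv'
  all_goals simp

theorem arc_notMem_avail (h : Trace activeRules i w app avail w' y) (hw : Ready w)
    (u v : Sym Letter K) : arcSym u v ∉ avail 8 := by
  have r7 : asideRule.Run i w (avail 7) (app 7) (avail 8) := h.run 7 (by decide)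
  intro hx
  exact r7.not_consume_le rfl rfl
    (mem_instances_asideRule.2 ⟨u, v, hw u v (Multiset.mem_of_le (h.avail_le (by decide)) hx), rfl⟩)
    (Multiset.singleton_le.2 hx)

theorem clock_mem_avail (h : Trace activeRules i w app avail w' y) {n : ℕ}
    (hn : clockSym n ∈ w) : clockSym n ∈ avail 8 := by
  refine h.mem_avail hn (by decide) (forall_instances (P := fun k g => k < 8 →
    clockSym n ∉ g.consume) ?_ ?_ ?_ ?_ ?_ ?_ ?_ ?_ ?_ ?_ ?_)
  all_goals simp

theorem exists_clockRule_app (h : Trace activeRules i w app avail w' y) {u v : Sym Letter K}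
    {n : ℕ} (hu : arcSym u v ∈ avail 8) (hn : clockSym n ∈ avail 8) : ∃ g, g ∈ app 8 := by
  have r8 : clockRule.Run i w (avail 8) (app 8) (avail 9) := h.run 8 (by decide)
  refine r8.exists_mem_apps (mem_instances_clockRule.2 ⟨u, v, n, rfl⟩) ?_
  rw [Multiset.le_iff_subset (by simp)]
  intro x hx
  rcases (by simpa using hx : x = arcSym u v ∨ x = clockSym n) with rfl | rfl
  · exact hu
  · exact hn

/-- The clock that advances need not be the given one, because the choice of the instance is free;
the invariant later identifies the two. -/
theorem clock_mem_content (h : Trace activeRules i w app avail w' y) {n : ℕ}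
    (hn : clockSym n ∈ w) (hw : ¬ Ready w) : ∃ m, clockSym m ∈ w ∧ clockSym (m + 1) ∈ w' := by
  have r8 : clockRule.Run i w (avail 8) (app 8) (avail 9) := h.run 8 (by decide)
  simp only [Ready, not_forall] at hw
  obtain ⟨u, v, hu, hv⟩ := hw
  obtain ⟨g, hg⟩ := exists_clockRule_app h (arc_mem_avail h hu hv) (clock_mem_avail h hn)
  have hc := (r8.consume_le hg).trans (h.avail_le (by decide))
  obtain ⟨u', v', m, rfl⟩ := mem_instances_clockRule.1 (r8.mem_instances hg)
  exact ⟨m, Multiset.mem_of_le hc (by simp),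
    (h.mem_content _).2 (Or.inr ⟨8, by decide, _, hg, by simp⟩)⟩

/-- `asideRule` has removed all facts from view, so `clockRule` finds no partner for the clock, and
`igniteRule` takes it. -/
theorem fire_mem_content_of_clock (h : Trace activeRules i w app avail w' y) {n : ℕ}
    (hn : clockSym n ∈ w) (hw : Ready w) : fireSym n ∈ w' := by
  have r8 : clockRule.Run i w (avail 8) (app 8) (avail 9) := h.run 8 (by decide)
  have r9 : igniteRule.Run i w (avail 9) (app 9) (avail 10) := h.run 9 (by decide)
  have h9 : clockSym n ∈ avail 9 := by
    refine (r8.mem_or (clock_mem_avail h hn)).resolve_right ?_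
    rintro ⟨g, hg, -⟩
    have hc := r8.consume_le hg
    obtain ⟨u, v, m, rfl⟩ := mem_instances_clockRule.1 (r8.mem_instances hg)
    exact arc_notMem_avail h hw u v (Multiset.mem_of_le hc (by simp))
  rcases r9.mem_or h9 with h10 | ⟨g, hg, hc⟩
  · exact (r9.not_consume_le rfl rfl (mem_instances_igniteRule.2 ⟨n, rfl⟩)
      (Multiset.singleton_le.2 h10)).elim
  · obtain ⟨m, rfl⟩ := mem_instances_igniteRule.1 (r9.mem_instances hg)
    obtain rfl : n = m := by simpa using hc
    exact (h.mem_content _).2 (Or.inr ⟨9, by decide, _, hg, by simp⟩)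

theorem countdown_app (h : Trace activeRules i w app avail w' y) {n : ℕ}
    (hn : fireSym (n + 1) ∈ w) :
    (⟨{fireSym (n + 1)}, {fireSym n}, {fireSym n}, 0⟩ : Ground Letter K) ∈ app 10 := by
  have r10 : countdownRule.Run i w (avail 10) (app 10) (avail 11) := h.run 10 (by decide)
  have h10 : fireSym (n + 1) ∈ avail 10 := by
    refine h.mem_avail hn (by decide) (forall_instances (P := fun k g => k < 10 →
      fireSym (n + 1) ∉ g.consume) ?_ ?_ ?_ ?_ ?_ ?_ ?_ ?_ ?_ ?_ ?_)
    all_goals simp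
  rcases r10.mem_or h10 with h11 | ⟨g, hg, hc⟩
  · exact (r10.not_consume_le rfl rfl (mem_instances_countdownRule.2 ⟨n, rfl⟩)
      (Multiset.singleton_le.2 h11)).elim
  · obtain ⟨m, rfl⟩ := mem_instances_countdownRule.1 (r10.mem_instances hg)
    obtain rfl : n = m := by simpa using hc
    exact hg

theorem fire_mem_content (h : Trace activeRules i w app avail w' y) {n : ℕ}
    (hn : fireSym (n + 1) ∈ w) : fireSym n ∈ w' :=
  (h.mem_content _).2 (Or.inr ⟨10, by decide, _, countdown_app h hn, by simp⟩)

theorem fire_mem_sent (h : Trace activeRules i w app avail w' y) {n : ℕ}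
    (hn : fireSym (n + 1) ∈ w) : fireSym n ∈ y :=
  (h.mem_sent _).2 ⟨10, by decide, _, countdown_app h hn, by simp⟩

theorem clock_cases (h : Trace activeRules i w app avail w' y) {n : ℕ} (hx : clockSym n ∈ w') :
    (startSym ∈ w ∧ n = 0) ∨ (¬ Ready w ∧ ∃ m, clockSym m ∈ w ∧ n = m + 1) := by
  refine content_cases h hx (fun hx => ?_) (forall_instances (P := fun k g => g ∈ app k →
    g.consume ≤ w → clockSym n ∈ g.produce → (startSym ∈ w ∧ n = 0) ∨
      (¬ Ready w ∧ ∃ m, clockSym m ∈ w ∧ n = m + 1)) ?_ ?_ ?_ ?_ ?_ ?_ ?_ ?_ ?_ ?_ ?_)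
  · have r9 : igniteRule.Run i w (avail 9) (app 9) (avail 10) := h.run 9 (by decide)
    exact (r9.not_consume_le rfl rfl (mem_instances_igniteRule.2 ⟨n, rfl⟩) (Multiset.singleton_le.2
      (Multiset.mem_of_le (h.avail_anti (by decide) (by decide)) hx))).elim
  case refine_10 =>
    intro u v m hg hc hx
    have r8 : clockRule.Run i w (avail 8) (app 8) (avail 9) := h.run 8 (by decide)
    refine Or.inr ⟨fun hw => ?_, m, Multiset.mem_of_le hc (by simp), by simpa using hx⟩
    exact arc_notMem_avail h hw u v (Multiset.mem_of_le (r8.consume_le hg) (by simp))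
  all_goals simp +contextual

open Classical in
-- The bound on the timers is required only in the presence of a clock, since a cell may receive the
-- countdown from several parents. The hypothesis `h0` excludes a stale `fireSym 0`, which no active
-- rule consumes.
theorem fire_cases (h : Trace activeRules i w app avail w' y) (h0 : fireSym 0 ∉ w)
    (hT : ∀ n, clockSym n ∈ w → w.countP IsTimer ≤ 1) {n : ℕ} (hx : fireSym n ∈ w') :
    fireSym (n + 1) ∈ w ∨ (clockSym n ∈ w ∧ Ready w) := by
  refine content_cases h hx (fun hx => ?_) (forall_instances (P := fun k g => g ∈ app k →
    g.consume ≤ w → fireSym n ∈ g.produce → fireSym (n + 1) ∈ w ∨ (clockSym n ∈ w ∧ Ready w))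
    ?_ ?_ ?_ ?_ ?_ ?_ ?_ ?_ ?_ ?_ ?_)
  · exfalso
    cases n with
    | zero => exact h0 (Multiset.mem_of_le (h.avail_le (by decide)) hx)
    | succ n =>
      have r10 : countdownRule.Run i w (avail 10) (app 10) (avail 11) := h.run 10 (by decide)
      exact r10.not_consume_le rfl rfl (mem_instances_countdownRule.2 ⟨n, rfl⟩)
        (Multiset.singleton_le.2 hx)
  case refine_11 =>
    intro m hg hc hx
    obtain rfl : n = m := by simpa using hx
    have hn := Multiset.singleton_le.1 hc
    refine Or.inr ⟨hn, fun u v hu => ?_⟩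
    -- If the general were not ready, `clockRule` would have taken one clock, so the clock being
    -- ignited would be a second timer.
    by_contra hv
    have r8 : clockRule.Run i w (avail 8) (app 8) (avail 9) := h.run 8 (by decide)
    have r9 : igniteRule.Run i w (avail 9) (app 9) (avail 10) := h.run 9 (by decide)
    obtain ⟨g, hg8⟩ := exists_clockRule_app h (arc_mem_avail h hu hv) (clock_mem_avail h hn)
    obtain ⟨u', v', m, rfl⟩ := mem_instances_clockRule.1 (r8.mem_instances hg8)
    have h8 := r8.avail_eq
    rw [r8.apps_eq_singleton rfl rfl hg8] at h8
    have h1 := Multiset.countP_le_of_le IsTimer (h.avail_le (k := 8) (by decide))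
    have h2 := hT n hn
    have h3 : 0 < (avail 9).countP IsTimer := Multiset.countP_pos.2
      ⟨clockSym n, Multiset.singleton_le.1 (r9.consume_le hg), by simp [IsTimer]⟩
    have h4 : 0 < (({arcSym u' v', clockSym m} : Multiset (Sym Letter K))).countP IsTimer :=
      Multiset.countP_pos.2 ⟨clockSym m, by simp, by simp [IsTimer]⟩
    rw [h8, Multiset.map_singleton, Multiset.sum_singleton, Multiset.countP_add] at h1
    dsimp only at h1
    omega
  case refine_12 =>
    intro m _ hc hx
    obtain rfl : n = m := by simpa using hx
    exact Or.inl (Multiset.singleton_le.1 hc)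
  all_goals simp

end Cell

/-! ## The steps of the whole system -/

section System

variable {K : Type} [Fintype K] {δ : K → K → Prop} {c c' : K → Multiset (Sym Letter K)}

open Classical in
/-- A global step from the contents `c` to the contents `c'` in which all cells stay active. -/
def Moves (δ : K → K → Prop) (c c' : K → Multiset (Sym Letter K)) : Prop :=
  ∃ w' y : K → Multiset (Sym Letter K), ∀ j,
    (∃ app avail, Trace activeRules j (c j) app avail (w' j) (y j)) ∧
      c' j = w' j + ∑ i with δ i j, y i

theorem Moves.exists_traces (h : Moves δ c c') : ∃ w' y : K → Multiset (Sym Letter K),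
    (∀ j, ∃ app avail, Trace activeRules j (c j) app avail (w' j) (y j)) ∧
      ∀ j x, x ∈ c' j ↔ x ∈ w' j ∨ ∃ i, δ i j ∧ x ∈ y i := by
  obtain ⟨w', y, h⟩ := h
  refine ⟨w', y, fun j => (h j).1, fun j x => ?_⟩
  rw [(h j).2, Multiset.mem_add, Multiset.mem_sum]
  simp

theorem moves_of_step {C C' : Config Letter Phase K} (h : Step prototype.rules δ C C')
    (hC : ∀ j, (C j).1 = .active) (h0 : ∀ j, fireSym 0 ∉ (C j).2) :
    (∀ j, (C' j).1 = .active) ∧ Moves δ (fun j => (C j).2) fun j => (C' j).2 := by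
  obtain ⟨w', y, h⟩ := h
  have := fun j => exists_trace (hC j ▸ (h j).1) (h0 j)
  exact ⟨fun j => (this j).1, w', y, fun j => ⟨(this j).2, (h j).2⟩⟩

theorem fired_of_step {C C' : Config Letter Phase K} (h : Step prototype.rules δ C C')
    (hC : ∀ j, (C j).1 = .active) (h0 : ∀ j, fireSym 0 ∈ (C j).2) (j : K) :
    (C' j).1 = .fired := by
  obtain ⟨w', y, h⟩ := h
  exact state_eq_fired (hC j ▸ (h j).1) (h0 j)

namespace Moves

theorem fact_self (h : Moves δ c c') {j : K} {x : Sym Letter K} (hx : factSym x ∈ c j) :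
    factSym x ∈ c' j := by
  obtain ⟨w', y, ht, hc⟩ := h.exists_traces
  obtain ⟨_, _, ht⟩ := ht j
  exact (hc j _).2 (Or.inl (fact_mem_content ht hx))

theorem fact_child (h : Moves δ c c') {i j : K} (hij : δ i j) {x : Sym Letter K}
    (hx : factSym x ∈ c i) : factSym x ∈ c' j := by
  obtain ⟨w', y, ht, hc⟩ := h.exists_traces
  obtain ⟨_, _, ht⟩ := ht i
  exact (hc j _).2 (Or.inr ⟨i, hij, fact_mem_sent ht hx⟩)

theorem hello_self (h : Moves δ c c') {j : K} {x : Sym Letter K} (hx : helloSym x ∈ c j) :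
    helloSym x ∈ c' j := by
  obtain ⟨w', y, ht, hc⟩ := h.exists_traces
  obtain ⟨_, _, ht⟩ := ht j
  exact (hc j _).2 (Or.inl (hello_mem_content ht hx))

theorem hello_child (h : Moves δ c c') {i j : K} (hij : δ i j) {x : Sym Letter K}
    (hx : helloSym x ∈ c i) : helloSym (.id i) ∈ c' j := by
  obtain ⟨w', y, ht, hc⟩ := h.exists_traces
  obtain ⟨_, _, ht⟩ := ht i
  exact (hc j _).2 (Or.inr ⟨i, hij, hello_mem_sent ht hx⟩)

theorem arc (h : Moves δ c c') {j : K} {x : Sym Letter K} (hx : helloSym x ∈ c j) :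
    arcSym x (.id j) ∈ c' j := by
  obtain ⟨w', y, ht, hc⟩ := h.exists_traces
  obtain ⟨_, _, ht⟩ := ht j
  exact (hc j _).2 (Or.inl (arc_mem_content ht hx))

theorem pulse (h : Moves δ c c') {j : K} {x : Sym Letter K} (hx : helloSym x ∈ c j) :
    pulseSym ∈ c' j := by
  obtain ⟨w', y, ht, hc⟩ := h.exists_traces
  obtain ⟨_, _, ht⟩ := ht j
  exact (hc j _).2 (Or.inl (pulse_mem_content ht hx))

theorem done (h : Moves δ c c') {j : K} (hp : pulseSym ∈ c j) (hk : KnowsChildren j (c j)) :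
    arcSym doneSym (.id j) ∈ c' j := by
  obtain ⟨w', y, ht, hc⟩ := h.exists_traces
  obtain ⟨_, _, ht⟩ := ht j
  exact (hc j _).2 (Or.inl (done_mem_content ht hp hk))

theorem start (h : Moves δ c c') {j : K} (hs : startSym ∈ c j) :
    clockSym 0 ∈ c' j ∧ helloSym startSym ∈ c' j ∧ arcSym startSym (.id j) ∈ c' j := by
  obtain ⟨w', y, ht, hc⟩ := h.exists_traces
  obtain ⟨_, _, ht⟩ := ht j
  obtain ⟨h1, h2, h3⟩ := start_mem_content ht hs
  exact ⟨(hc j _).2 (Or.inl h1), (hc j _).2 (Or.inl h2), (hc j _).2 (Or.inl h3)⟩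

theorem clock (h : Moves δ c c') {j : K} {n : ℕ} (hn : clockSym n ∈ c j) (hr : ¬ Ready (c j)) :
    ∃ m, clockSym m ∈ c j ∧ clockSym (m + 1) ∈ c' j := by
  obtain ⟨w', y, ht, hc⟩ := h.exists_traces
  obtain ⟨_, _, ht⟩ := ht j
  obtain ⟨m, h1, h2⟩ := clock_mem_content ht hn hr
  exact ⟨m, h1, (hc j _).2 (Or.inl h2)⟩

theorem fire_of_clock (h : Moves δ c c') {j : K} {n : ℕ} (hn : clockSym n ∈ c j)
    (hr : Ready (c j)) : fireSym n ∈ c' j := by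
  obtain ⟨w', y, ht, hc⟩ := h.exists_traces
  obtain ⟨_, _, ht⟩ := ht j
  exact (hc j _).2 (Or.inl (fire_mem_content_of_clock ht hn hr))

theorem fire_self (h : Moves δ c c') {j : K} {n : ℕ} (hn : fireSym (n + 1) ∈ c j) :
    fireSym n ∈ c' j := by
  obtain ⟨w', y, ht, hc⟩ := h.exists_traces
  obtain ⟨_, _, ht⟩ := ht j
  exact (hc j _).2 (Or.inl (fire_mem_content ht hn))

theorem fire_child (h : Moves δ c c') {i j : K} (hij : δ i j) {n : ℕ}
    (hn : fireSym (n + 1) ∈ c i) : fireSym n ∈ c' j := by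
  obtain ⟨w', y, ht, hc⟩ := h.exists_traces
  obtain ⟨_, _, ht⟩ := ht i
  exact (hc j _).2 (Or.inr ⟨i, hij, fire_mem_sent ht hn⟩)

theorem start_notMem (h : Moves δ c c') (j : K) : startSym ∉ c' j := by
  obtain ⟨w', y, ht, hc⟩ := h.exists_traces
  rw [hc]
  rintro (hx | ⟨i, -, hx⟩)
  · obtain ⟨_, _, ht⟩ := ht j
    exact start_notMem_content ht hx
  · obtain ⟨_, _, ht⟩ := ht i
    exact elem_notMem_sent ht _ hx

theorem pulse_cases (h : Moves δ c c') {j : K} (hx : pulseSym ∈ c' j) :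
    pulseSym ∈ c j ∨ ∃ v, helloSym v ∈ c j := by
  obtain ⟨w', y, ht, hc⟩ := h.exists_traces
  rcases (hc j _).1 hx with hx | ⟨i, -, hx⟩
  · obtain ⟨_, _, ht⟩ := ht j
    exact FiringSquad.pulse_cases ht hx
  · obtain ⟨_, _, ht⟩ := ht i
    exact (elem_notMem_sent ht _ hx).elim

theorem hello_cases (h : Moves δ c c') {j : K} {x : Sym Letter K} (hx : helloSym x ∈ c' j) :
    helloSym x ∈ c j ∨ (startSym ∈ c j ∧ x = startSym) ∨
      ∃ i, δ i j ∧ x = .id i ∧ ∃ v, helloSym v ∈ c i := by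
  obtain ⟨w', y, ht, hc⟩ := h.exists_traces
  rcases (hc j _).1 hx with hx | ⟨i, hij, hx⟩
  · obtain ⟨_, _, ht⟩ := ht j
    have := FiringSquad.hello_cases ht hx
    tauto
  · obtain ⟨_, _, ht⟩ := ht i
    obtain ⟨h1, h2⟩ := hello_sent_cases ht hx
    exact Or.inr (Or.inr ⟨i, hij, h2, h1⟩)

open Classical in
theorem fact_cases (h : Moves δ c c') {j : K} (hp : (c j).count pulseSym ≤ 1) {x : Sym Letter K}
    (hx : factSym x ∈ c' j) : (factSym x ∈ c j ∨ ∃ i, δ i j ∧ factSym x ∈ c i) ∨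
      (startSym ∈ c j ∧ x = .pair startSym (.id j)) ∨
      (∃ v, helloSym v ∈ c j ∧ x = .pair v (.id j)) ∨
      (x = .pair doneSym (.id j) ∧ pulseSym ∈ c j ∧ KnowsChildren j (c j)) := by
  obtain ⟨w', y, ht, hc⟩ := h.exists_traces
  rcases (hc j _).1 hx with hx | ⟨i, hij, hx⟩
  · obtain ⟨_, _, ht⟩ := ht j
    exact (FiringSquad.fact_cases ht hp hx).imp_left Or.inl
  · obtain ⟨_, _, ht⟩ := ht i
    exact Or.inl (Or.inr ⟨i, hij, fact_sent_cases ht hx⟩)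

theorem clock_cases (h : Moves δ c c') {j : K} {n : ℕ} (hx : clockSym n ∈ c' j) :
    (startSym ∈ c j ∧ n = 0) ∨ (¬ Ready (c j) ∧ ∃ m, clockSym m ∈ c j ∧ n = m + 1) := by
  obtain ⟨w', y, ht, hc⟩ := h.exists_traces
  rcases (hc j _).1 hx with hx | ⟨i, hij, hx⟩
  · obtain ⟨_, _, ht⟩ := ht j
    exact FiringSquad.clock_cases ht hx
  · obtain ⟨_, _, ht⟩ := ht i
    exact (clock_notMem_sent ht _ hx).elim

open Classical in
theorem fire_cases (h : Moves δ c c') {j : K} (h0 : fireSym 0 ∉ c j)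
    (hT : ∀ n, clockSym n ∈ c j → (c j).countP IsTimer ≤ 1) {n : ℕ} (hx : fireSym n ∈ c' j) :
    fireSym (n + 1) ∈ c j ∨ (∃ i, δ i j ∧ fireSym (n + 1) ∈ c i) ∨
      (clockSym n ∈ c j ∧ Ready (c j)) := by
  obtain ⟨w', y, ht, hc⟩ := h.exists_traces
  rcases (hc j _).1 hx with hx | ⟨i, hij, hx⟩
  · obtain ⟨_, _, ht⟩ := ht j
    have := FiringSquad.fire_cases ht h0 hT hx
    tauto
  · obtain ⟨_, _, ht⟩ := ht i
    exact Or.inr (Or.inl ⟨i, hij, fire_sent_cases ht hx⟩)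

open Classical in
-- Symbols of a kind that is never sent are unaffected by the messages, so the count reduces to that
-- of a single cell.
theorem exists_countP_eq (h : Moves δ c c') (j : K) (p : Sym Letter K → Prop)
    (hp : ∀ i x y app avail u, Trace activeRules i (c i) app avail u y → p x → x ∉ y) :
    ∃ u y app avail, Trace activeRules j (c j) app avail u y ∧ (c' j).countP p = u.countP p := by
  obtain ⟨u, y, h⟩ := h
  obtain ⟨⟨app, avail, ht⟩, hc⟩ := h j
  refine ⟨u j, y j, app, avail, ht, ?_⟩
  rw [hc, Multiset.countP_add, Nat.add_eq_left, Multiset.countP_eq_zero]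
  intro x hx hpx
  obtain ⟨i, -, hx⟩ := Multiset.mem_sum.1 hx
  obtain ⟨⟨_, _, ht⟩, -⟩ := h i
  exact hp i x _ _ _ _ ht hpx hx

open Classical in
theorem count_eq (h : Moves δ c c') (j : K) :
    (c' j).count countSym = (c j).count countSym := by
  obtain ⟨u, y, app, avail, ht, hu⟩ := h.exists_countP_eq j (countSym = ·)
    (by rintro i x y app avail u ht rfl; exact elem_notMem_sent ht _)
  exact hu.trans (count_content ht)

open Classical in
theorem pulse_count_le (h : Moves δ c c') (j : K) : (c' j).count pulseSym ≤ 1 := by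
  obtain ⟨u, y, app, avail, ht, hu⟩ := h.exists_countP_eq j (pulseSym = ·)
    (by rintro i x y app avail u ht rfl; exact elem_notMem_sent ht _)
  exact hu.trans_le (pulse_count_content_le ht)

open Classical in
-- The hypothesis `hf` is needed because the countdown, unlike the clock, is copied to the children.
theorem timer_eq (h : Moves δ c c') (hf : ∀ i n, fireSym n ∉ c i) (j : K) :
    (c' j).countP IsTimer = (c j).countP IsTimer := by
  obtain ⟨u, y, app, avail, ht, hu⟩ := h.exists_countP_eq j IsTimer (by
    rintro i x y app avail u ht (rfl | ⟨n, rfl⟩ | ⟨n, rfl⟩) hx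
    · exact elem_notMem_sent ht _ hx
    · exact clock_notMem_sent ht _ hx
    · exact hf i _ (fire_sent_cases ht hx))
  exact hu.trans (timer_content ht)

end Moves

end System

/-! ## Distances -/

section Walks

variable {K : Type} {δ : K → K → Prop}

theorem walkOfLength_dist (h : StronglyConnected δ) (i j : K) :
    WalkOfLength δ (dist δ i j) i j :=
  Nat.sInf_mem (h i j)

theorem exists_walkOfLength_le_ecc [Fintype K] (h : StronglyConnected δ) (i j : K) :
    ∃ n ≤ ecc δ i, WalkOfLength δ n i j :=
  ⟨_, Finset.le_sup (f := fun j => dist δ i j) (Finset.mem_univ j), walkOfLength_dist h i j⟩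

theorem ecc_le_diam [Fintype K] (i : K) : ecc δ i ≤ diam δ :=
  Finset.le_sup (f := fun i => ecc δ i) (Finset.mem_univ i)

theorem ecc_pos [Fintype K] [Nontrivial K] (h : StronglyConnected δ) (i : K) : 0 < ecc δ i := by
  obtain ⟨j, hj⟩ := exists_ne i
  obtain ⟨n, hn, hw⟩ := exists_walkOfLength_le_ecc h i j
  cases n with
  | zero => exact (hj hw.symm).elim
  | succ n => omega

end Walks

/-! ## Before the countdown -/

section Invariant

variable {K : Type} {δ : K → K → Prop} {g : K} {t : ℕ}
  {c c' : K → Multiset (Sym Letter K)}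

open Classical in
/-- What holds for the contents `c` at time `t`, as long as the countdown has not started. -/
structure Invariant (δ : K → K → Prop) (g : K) (t : ℕ) (c : K → Multiset (Sym Letter K)) :
    Prop where
  count_eq : ∀ j, (c j).count countSym = outdegree δ j
  pulse_count_le : ∀ j, (c j).count pulseSym ≤ 1
  timer_le : ∀ j, (c j).countP IsTimer ≤ 1
  start : ∀ j, startSym ∈ c j → j = g ∧ t = 0
  pulse : ∀ j, pulseSym ∈ c j → ∃ n < t, WalkOfLength δ n g j
  hello : ∀ j x, helloSym x ∈ c j →
    (∃ n < t, WalkOfLength δ n g j) ∧ (x = startSym ∨ ∃ i, x = .id i ∧ δ i j)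
  fact : ∀ j x, factSym x ∈ c j → ∃ u k, x = .pair u (.id k) ∧
    (∃ n < t, WalkOfLength δ n g k) ∧ (u = startSym ∨ u = doneSym ∨ ∃ i, u = .id i ∧ δ i k)
  closed : ∀ j k, arcSym doneSym (.id k) ∈ c j → ∀ l, δ k l → arcSym (.id k) (.id l) ∈ c j
  clock : ∀ j n, clockSym n ∈ c j → j = g ∧ n + 1 = t
  fire : ∀ j n, fireSym n ∉ c j
  general : (t = 0 ∧ startSym ∈ c g) ∨
    (∃ n, t = n + 1 ∧ clockSym n ∈ c g ∧ helloSym startSym ∈ c g ∧ arcSym startSym (.id g) ∈ c g)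

theorem outdegree_eq_card [Fintype K] (δ : K → K → Prop) (j : K) [DecidablePred (δ j)] :
    outdegree δ j = (Finset.univ.filter (δ j)).card := by
  rw [outdegree, ← Set.ncard_coe_finset]
  simp

/-- A cell that has heard of as many children as it has, has heard of all of them. -/
theorem Invariant.arc_of_knowsChildren [Fintype K] (hI : Invariant δ g t c) {j : K}
    (hk : KnowsChildren j (c j)) {l : K} (hl : δ j l) : arcSym (.id j) (.id l) ∈ c j := by
  classical
  obtain ⟨V, hV, hVw⟩ := hk
  rw [hI.count_eq, outdegree_eq_card] at hV
  have hsub : V ⊆ (Finset.univ.filter (δ j)).image Sym.id := by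
    intro v hv
    -- By the invariant, known arcs out of `j` are genuine, so `V` lies among the children; equal
    -- cardinality then leaves no child out.
    obtain ⟨u, k, hx, -, hu⟩ := hI.fact j _ (hVw v hv)
    obtain ⟨rfl, rfl⟩ := Sym.pair.inj hx
    rcases hu with hu | hu | ⟨i, hu, hi⟩
    · cases hu
    · cases hu
    · cases hu
      exact Finset.mem_image_of_mem _ (by simpa using hi)
  have heq := Finset.eq_of_subset_of_card_le hsub (Finset.card_image_le.trans hV)
  exact hVw _ (heq ▸ Finset.mem_image_of_mem _ (by simpa using hl))

theorem Invariant.knowsChildren [Fintype K] (hI : Invariant δ g t c) {j : K}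
    (h : ∀ l, δ j l → arcSym (.id j) (.id l) ∈ c j) : KnowsChildren j (c j) := by
  classical
  refine ⟨(Finset.univ.filter (δ j)).image Sym.id, ?_, ?_⟩
  · rw [hI.count_eq, outdegree_eq_card, Finset.card_image_of_injective]
    intro a b hab
    simpa using hab
  · intro v hv
    obtain ⟨l, hl, rfl⟩ := Finset.mem_image.1 hv
    exact h l (by simpa using hl)

/-- Time 0 is exempt in `hr`: the general is then vacuously ready, but it has no clock to ignite. -/
theorem Invariant.step [Fintype K] (hI : Invariant δ g t c) (h : Moves δ c c')
    (hr : 0 < t → ¬ Ready (c g)) : Invariant δ g (t + 1) c' where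
  count_eq j := (h.count_eq j).trans (hI.count_eq j)
  pulse_count_le := h.pulse_count_le
  timer_le j := (h.timer_eq hI.fire j).trans_le (hI.timer_le j)
  start j hj := (h.start_notMem j hj).elim
  pulse j hj := by
    rcases h.pulse_cases hj with hj | ⟨v, hv⟩
    · obtain ⟨n, hn, hw⟩ := hI.pulse j hj
      exact ⟨n, by omega, hw⟩
    · obtain ⟨n, hn, hw⟩ := (hI.hello j v hv).1
      exact ⟨n, by omega, hw⟩
  hello j x hx := by
    rcases h.hello_cases hx with hx | ⟨hs, rfl⟩ | ⟨i, hij, rfl, v, hv⟩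
    · obtain ⟨⟨n, hn, hw⟩, hx⟩ := hI.hello j x hx
      exact ⟨⟨n, by omega, hw⟩, hx⟩
    · obtain ⟨rfl, rfl⟩ := hI.start j hs
      exact ⟨⟨0, by omega, rfl⟩, Or.inl rfl⟩
    · obtain ⟨n, hn, hw⟩ := (hI.hello i v hv).1
      exact ⟨⟨n + 1, by omega, i, hw, hij⟩, Or.inr ⟨i, rfl, hij⟩⟩
  fact j x hx := by
    rcases h.fact_cases (hI.pulse_count_le j) hx with hx | ⟨hs, rfl⟩ | ⟨v, hv, rfl⟩ | ⟨rfl, hp, -⟩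
    · have : ∃ i, factSym x ∈ c i := by
        rcases hx with hx | ⟨i, -, hx⟩
        exacts [⟨j, hx⟩, ⟨i, hx⟩]
      obtain ⟨i, hx⟩ := this
      obtain ⟨u, k, rfl, ⟨n, hn, hw⟩, hu⟩ := hI.fact i x hx
      exact ⟨u, k, rfl, ⟨n, by omega, hw⟩, hu⟩
    · obtain ⟨rfl, rfl⟩ := hI.start j hs
      exact ⟨_, _, rfl, ⟨0, by omega, rfl⟩, Or.inl rfl⟩
    · obtain ⟨⟨n, hn, hw⟩, hx⟩ := hI.hello j v hv
      exact ⟨_, _, rfl, ⟨n, by omega, hw⟩, hx.imp_right Or.inr⟩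
    · obtain ⟨n, hn, hw⟩ := hI.pulse j hp
      exact ⟨_, _, rfl, ⟨n, by omega, hw⟩, Or.inr (Or.inl rfl)⟩
  closed j k hx l hl := by
    -- An old done fact arrives together with its arcs, by flooding; a new one was made by the cell
    -- itself, which then holds all of its own arcs. Greetings never carry `doneSym`.
    rcases h.fact_cases (hI.pulse_count_le j) hx with (hx | ⟨i, hij, hx⟩) | ⟨-, hx⟩ |
      ⟨v, hv, hx⟩ | ⟨hx, -, hk⟩
    · exact h.fact_self (hI.closed j k hx l hl)
    · exact h.fact_child hij (hI.closed i k hx l hl)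
    · cases hx
    · cases hx
      rcases (hI.hello j _ hv).2 with hx | ⟨i, hx, -⟩ <;> cases hx
    · cases hx
      exact h.fact_self (hI.arc_of_knowsChildren hk hl)
  clock j n hn := by
    rcases h.clock_cases hn with ⟨hs, rfl⟩ | ⟨-, m, hm, rfl⟩
    · obtain ⟨rfl, rfl⟩ := hI.start j hs
      exact ⟨rfl, rfl⟩
    · obtain ⟨rfl, rfl⟩ := hI.clock j m hm
      exact ⟨rfl, rfl⟩
  fire j n hn := by
    rcases h.fire_cases (hI.fire j 0) (fun _ _ => hI.timer_le j) hn with hn | ⟨i, -, hn⟩ | ⟨hn, hj⟩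
    · exact hI.fire j _ hn
    · exact hI.fire i _ hn
    · obtain ⟨rfl, rfl⟩ := hI.clock j n hn
      exact hr (by omega) hj
  general := by
    right
    rcases hI.general with ⟨rfl, hs⟩ | ⟨n, rfl, h1, h2, h3⟩
    · exact ⟨0, rfl, h.start hs⟩
    · obtain ⟨m, hm, hm'⟩ := h.clock h1 (hr (by omega))
      obtain ⟨-, hmn⟩ := hI.clock g m hm
      exact ⟨m + 1, by omega, hm', h.hello_self h2, h.fact_self h3⟩

open Classical in
theorem init_content (j : K) : (prototype.init δ g j).2 =
    Multiset.replicate (outdegree δ j) countSym + if j = g then {startSym} else 0 :=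
  rfl

theorem invariant_init : Invariant δ g 0 fun j => (prototype.init δ g j).2 := by
  classical
  have hmem : ∀ j x, x ∈ (prototype.init δ g j).2 → x = countSym ∨ (x = startSym ∧ j = g) := by
    intro j x hx
    rw [init_content, Multiset.mem_add] at hx
    rcases hx with hx | hx
    · exact Or.inl (Multiset.eq_of_mem_replicate hx)
    · split_ifs at hx with hj
      · exact Or.inr ⟨by simpa using hx, hj⟩
      · simp at hx
  have helem : ∀ j l, .elem l ∈ (prototype.init δ g j).2 → l ≠ .pulse := by
    rintro j l hl rfl
    simpa using hmem j _ hl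
  have hpair : ∀ j s t, .pair s t ∉ (prototype.init δ g j).2 := by
    intro j s t hx
    simpa using hmem j _ hx
  refine ⟨fun j => ?_, fun j => ?_, fun j => ?_, fun j hj => ?_, fun j hj => ?_,
    fun j x hx => (hpair j _ _ hx).elim, fun j x hx => (hpair j _ _ hx).elim,
    fun j k hx => (hpair j _ _ hx).elim, fun j n hx => (hpair j _ _ hx).elim,
    fun j n hx => hpair j _ _ hx, Or.inl ⟨rfl, ?_⟩⟩
  · rw [init_content, Multiset.count_add]
    split_ifs <;> simp
  · rw [Multiset.count_eq_zero_of_notMem fun hx => helem j _ hx rfl]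
    omega
  · rw [init_content, Multiset.countP_add, (Multiset.countP_eq_zero (p := IsTimer)).2, zero_add]
    · exact (Multiset.countP_le_card _ _).trans (by split_ifs <;> simp)
    · intro x hx
      rw [Multiset.eq_of_mem_replicate hx]
      simp [IsTimer]
  · simpa using hmem j _ hj
  · exact (helem j _ hj rfl).elim
  · simp [init_content]

end Invariant

/-! ## The evolution -/

section Evolution

variable {K : Type} {δ : K → K → Prop} {g : K} {ev : ℕ → Config Letter Phase K}

/-- All cells are active at time `t`, and the countdown has not started. -/
structure Exploring (δ : K → K → Prop) (g : K) (ev : ℕ → Config Letter Phase K) (t : ℕ) :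
    Prop where
  active : ∀ j, (ev t j).1 = .active
  invariant : Invariant δ g t fun j => (ev t j).2

theorem Exploring.moves [Fintype K] {t : ℕ} (h : Exploring δ g ev t)
    (hev : IsEvolution prototype.rules δ (prototype.init δ g) ev) :
    (∀ j, (ev (t + 1) j).1 = .active) ∧
      Moves δ (fun j => (ev t j).2) fun j => (ev (t + 1) j).2 :=
  moves_of_step (hev.2 t) h.active fun j => h.invariant.fire j 0

theorem exploring_of_not_ready [Fintype K] (hev : IsEvolution prototype.rules δ (prototype.init δ g) ev)
    (t : ℕ) (hr : ∀ s < t, 0 < s → ¬ Ready (ev s g).2) : Exploring δ g ev t := by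
  induction t with
  | zero =>
    refine ⟨fun j => ?_, ?_⟩
    · rw [hev.1]; rfl
    · have := invariant_init (δ := δ) (g := g)
      rwa [← hev.1] at this
  | succ t ih =>
    have hE := ih fun s hs => hr s (by omega)
    obtain ⟨h1, h2⟩ := hE.moves hev
    exact ⟨h1, hE.invariant.step h2 fun ht => hr t (by omega) ht⟩

/-- The wave of greetings crosses one arc per step. The inequality is strict because the general
spends the first step on greeting itself. -/
theorem exists_hello_mem [Fintype K] {B : ℕ} (hE : ∀ t ≤ B, Exploring δ g ev t)
    (hev : IsEvolution prototype.rules δ (prototype.init δ g) ev)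
    {n t : ℕ} {j : K} (hw : WalkOfLength δ n g j) (hnt : n < t)
    (ht : t ≤ B) : ∃ v, helloSym v ∈ (ev t j).2 := by
  induction n generalizing t j with
  | zero =>
    obtain rfl : g = j := hw
    rcases (hE t ht).invariant.general with ⟨rfl, -⟩ | ⟨n, -, -, h, -⟩
    · omega
    · exact ⟨_, h⟩
  | succ n ih =>
    obtain ⟨k, hw, hkj⟩ := hw
    obtain ⟨t, rfl⟩ : ∃ s, t = s + 1 := ⟨t - 1, by omega⟩
    obtain ⟨v, hv⟩ := ih hw (t := t) (by omega) (by omega)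
    exact ⟨_, ((hE t (by omega)).moves hev).2.hello_child hkj hv⟩

theorem fact_mem_of_walk [Fintype K] {B : ℕ} (hE : ∀ t ≤ B, Exploring δ g ev t)
    (hev : IsEvolution prototype.rules δ (prototype.init δ g) ev)
    {n t : ℕ} {i j : K} {x : Sym Letter K} (hx : factSym x ∈ (ev t i).2)
    (hw : WalkOfLength δ n i j) {t' : ℕ} (ht' : t + n ≤ t') (hB : t' ≤ B) :
    factSym x ∈ (ev t' j).2 := by
  have hself : ∀ (k : K) (s s' : ℕ), s ≤ s' → s' ≤ B → factSym x ∈ (ev s k).2 →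
      factSym x ∈ (ev s' k).2 := by
    intro k s s' hs
    induction s', hs using Nat.le_induction with
    | base => exact fun _ h => h
    | succ s' _ ih =>
      exact fun hB h => ((hE s' (by omega)).moves hev).2.fact_self (ih (by omega) h)
  induction n generalizing j t' with
  | zero =>
    obtain rfl : i = j := hw
    exact hself i t t' (by omega) hB hx
  | succ n ih =>
    obtain ⟨k, hw, hkj⟩ := hw
    obtain ⟨s, rfl⟩ : ∃ s, t' = s + 1 := ⟨t' - 1, by omega⟩
    exact ((hE s (by omega)).moves hev).2.fact_child hkj (ih hw (t' := s) (by omega) (by omega))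

/-- The term e is the time of the greetings, and each D pays for one flooding: of the arcs to the
parents, then of the done facts to the general. -/
theorem ready_of_le [Fintype K] {B : ℕ} (hE : ∀ t ≤ B, Exploring δ g ev t)
    (hev : IsEvolution prototype.rules δ (prototype.init δ g) ev)
    (hδ : StronglyConnected δ) (hB : B = ecc δ g + 2 * diam δ + 4) :
    Ready (ev B g).2 := by
  set e := ecc δ g
  set D := diam δ
  have hwalk : ∀ i j, ∃ n ≤ D, WalkOfLength δ n i j := fun i j => by
    obtain ⟨n, hn, hw⟩ := exists_walkOfLength_le_ecc hδ i j
    exact ⟨n, hn.trans (ecc_le_diam i), hw⟩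
  have hello : ∀ t, e < t → t ≤ B → ∀ j, ∃ v, helloSym v ∈ (ev t j).2 := by
    intro t ht htB j
    obtain ⟨n, hn, hw⟩ := exists_walkOfLength_le_ecc hδ g j
    exact exists_hello_mem hE hev hw (by omega) htB
  -- The parent is awake at e + 1, its child is greeted by e + 2 and records the arc by e + 3;
  -- flooding back to the parent takes at most D more steps.
  have arc : ∀ j k, δ j k → arcSym (.id j) (.id k) ∈ (ev (e + 3 + D) j).2 := by
    intro j k hjk
    obtain ⟨v, hv⟩ := hello (e + 1) (by omega) (by omega) j
    have h2 := ((hE (e + 1) (by omega)).moves hev).2.hello_child hjk hv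
    have h3 := ((hE (e + 2) (by omega)).moves hev).2.arc h2
    obtain ⟨n, hn, hw⟩ := hwalk k j
    exact fact_mem_of_walk hE hev h3 hw (by omega) (by omega)
  -- At e + 3 + D the cell has a pulse and knows its children, so the done fact appears one step
  -- later and reaches the general within D further steps.
  have done : ∀ j, arcSym doneSym (.id j) ∈ (ev B g).2 := by
    intro j
    obtain ⟨v, hv⟩ := hello (e + 2 + D) (by omega) (by omega) j
    have hp := ((hE (e + 2 + D) (by omega)).moves hev).2.pulse hv
    rw [show e + 2 + D + 1 = e + 3 + D by omega] at hp
    have hX := hE (e + 3 + D) (by omega)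
    have h4 := (hX.moves hev).2.done hp (hX.invariant.knowsChildren (arc j))
    obtain ⟨n, hn, hw⟩ := hwalk j g
    exact fact_mem_of_walk hE hev h4 hw (by omega) le_rfl
  intro u v hu
  obtain ⟨u', k, hx, -⟩ := (hE B le_rfl).invariant.fact g _ hu
  obtain ⟨rfl, rfl⟩ := Sym.pair.inj hx
  exact done k

/-- When the general is ready, it has heard of all cells. -/
theorem Exploring.exists_walk_lt {τ : ℕ} (h : Exploring δ g ev τ) (hτ : 0 < τ)
    (hr : Ready (ev τ g).2) (hδ : StronglyConnected δ) (j : K) :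
    ∃ n < τ, WalkOfLength δ n g j := by
  -- Readiness and the field `closed` alternate along a walk: a done cell has its children named,
  -- and every named cell is done. The virtual parent of the general supplies the base case.
  have done : ∀ n j, WalkOfLength δ n g j → arcSym doneSym (.id j) ∈ (ev τ g).2 := by
    intro n
    induction n with
    | zero =>
      rintro j rfl
      rcases h.invariant.general with ⟨rfl, -⟩ | ⟨n, -, -, -, h⟩
      · omega
      · exact hr _ _ h
    | succ n ih =>
      rintro j ⟨k, hw, hkj⟩
      exact hr _ _ (h.invariant.closed g k (ih k hw) j hkj)
  obtain ⟨n, hn⟩ := hδ g j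
  obtain ⟨u, k, hx, hw, -⟩ := h.invariant.fact g _ (done n j hn)
  cases hx
  exact hw

/-- The countdown, which the general has started in the step after time `τ`. -/
structure Counting (δ : K → K → Prop) (g : K) (ev : ℕ → Config Letter Phase K) (τ t : ℕ) :
    Prop where
  active : ∀ j, (ev t j).1 = .active
  start : ∀ j, startSym ∉ (ev t j).2
  clock : ∀ j n, clockSym n ∉ (ev t j).2
  fire : ∀ j n, fireSym n ∈ (ev t j).2 ↔
    n + t = 2 * τ ∧ ∃ m, m + τ + 1 ≤ t ∧ WalkOfLength δ m g j

/-- At time τ the clock shows τ - 1, so the countdown appears with this value at time τ + 1, in the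
general only. -/
theorem Exploring.counting [Fintype K] {τ : ℕ} (h : Exploring δ g ev τ) (hτ : 0 < τ)
    (hr : Ready (ev τ g).2) (hev : IsEvolution prototype.rules δ (prototype.init δ g) ev) :
    Counting δ g ev τ (τ + 1) := by
  obtain ⟨h1, h2⟩ := h.moves hev
  have hI := h.invariant
  refine ⟨h1, h2.start_notMem, fun j n hn => ?_, fun j n => ⟨fun hn => ?_, ?_⟩⟩
  · rcases h2.clock_cases hn with ⟨hs, -⟩ | ⟨hj, m, hm, -⟩
    · have := (hI.start j hs).2
      omega
    · obtain ⟨rfl, -⟩ := hI.clock j m hm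
      exact hj hr
  · rcases h2.fire_cases (hI.fire j 0) (fun _ _ => hI.timer_le j) hn with hn | ⟨i, -, hn⟩ | ⟨hn, -⟩
    · exact (hI.fire j _ hn).elim
    · exact (hI.fire i _ hn).elim
    · obtain ⟨rfl, hn⟩ := hI.clock j n hn
      exact ⟨by omega, 0, by omega, rfl⟩
  · rintro ⟨hn, m, hm, hw⟩
    obtain rfl : m = 0 := by omega
    obtain rfl : g = j := hw
    rcases hI.general with ⟨rfl, -⟩ | ⟨k, hk, hc, -⟩
    · omega
    · obtain rfl : k = n := by omega
      exact h2.fire_of_clock hc hr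

/-- Passing to a child or staying in place lowers the value by one per step in either case, so the
sum of value and time is the same for all copies. -/
theorem Counting.step [Fintype K] {τ t : ℕ} (h : Counting δ g ev τ t) (hτ : τ < t) (ht : t < 2 * τ)
    (hev : IsEvolution prototype.rules δ (prototype.init δ g) ev) :
    Counting δ g ev τ (t + 1) := by
  have h0 : ∀ j, fireSym 0 ∉ (ev t j).2 := fun j hj => by
    have := ((h.fire j 0).1 hj).1
    omega
  obtain ⟨h1, h2⟩ := moves_of_step (hev.2 t) h.active h0
  refine ⟨h1, h2.start_notMem, fun j n hn => ?_, fun j n => ⟨fun hn => ?_, ?_⟩⟩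
  · rcases h2.clock_cases hn with ⟨hs, -⟩ | ⟨-, m, hm, -⟩
    · exact h.start j hs
    · exact h.clock j m hm
  · rcases h2.fire_cases (h0 j) (fun n hn => (h.clock j n hn).elim) hn with
      hn | ⟨i, hij, hn⟩ | ⟨hn, -⟩
    · obtain ⟨hn, m, hm, hw⟩ := (h.fire j _).1 hn
      exact ⟨by omega, m, by omega, hw⟩
    · obtain ⟨hn, m, hm, hw⟩ := (h.fire i _).1 hn
      exact ⟨by omega, m + 1, by omega, i, hw, hij⟩
    · exact (h.clock j n hn).elim
  · rintro ⟨hn, m, hm, hw⟩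
    -- Either the cell had already been reached, or the walk is just long enough and its last arc
    -- delivers the countdown in this step.
    by_cases hmt : m + τ + 1 ≤ t
    · exact h2.fire_self ((h.fire j (n + 1)).2 ⟨by omega, m, hmt, hw⟩)
    · obtain ⟨m, rfl⟩ : ∃ k, m = k + 1 := ⟨m - 1, by omega⟩
      obtain ⟨i, hw, hij⟩ := hw
      exact h2.fire_child hij ((h.fire i (n + 1)).2 ⟨by omega, m, by omega, hw⟩)

theorem firesAt [Fintype K] (hev : IsEvolution prototype.rules δ (prototype.init δ g) ev)
    (hδ : StronglyConnected δ) :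
    ∃ T, prototype.FiresAt ev T ∧ T ≤ 2 * (ecc δ g + 2 * diam δ + 4) + 1 := by
  classical
  have hex : ∃ τ, 0 < τ ∧ τ ≤ ecc δ g + 2 * diam δ + 4 ∧ Ready (ev τ g).2 := by
    by_contra! hn
    refine hn _ (by omega) le_rfl (ready_of_le (fun t ht => ?_) hev hδ rfl)
    exact exploring_of_not_ready hev t fun s hs h0 => hn s h0 (by omega)
  -- Minimality of τ is what keeps the exploration invariant valid up to time τ.
  obtain ⟨hτ, hle, hr⟩ := Nat.find_spec hex
  set τ := Nat.find hex
  have hE : ∀ t ≤ τ, Exploring δ g ev t := fun t ht =>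
    exploring_of_not_ready hev t fun s hs h0 hs' =>
      Nat.find_min hex (hs.trans_le ht) ⟨h0, by omega, hs'⟩
  have hC : ∀ t, τ + 1 ≤ t → t ≤ 2 * τ → Counting δ g ev τ t := by
    intro t ht
    induction t, ht using Nat.le_induction with
    | base => exact fun _ => (hE τ le_rfl).counting hτ hr hev
    | succ t ht ih => exact fun h => (ih (by omega)).step (by omega) (by omega) hev
  have hlast := hC (2 * τ) (by omega) le_rfl
  have hfired : ∀ j, (ev (2 * τ + 1) j).1 = .fired :=
    fired_of_step (hev.2 _) hlast.active fun j => by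
      obtain ⟨n, hn, hw⟩ := (hE τ le_rfl).exists_walk_lt hτ hr hδ j
      -- A walk shorter than τ is exactly what the countdown can cover by time 2τ.
      exact (hlast.fire j 0).2 ⟨by omega, n, by omega, hw⟩
  refine ⟨2 * τ + 1, ⟨by omega, fun t ht j => ?_, hfired, fun j r hr' => ?_⟩, by omega⟩
  · have : (ev t j).1 = .active := by
      rcases le_or_gt t τ with h | h
      · exact (hE t h).active j
      · exact (hC t (by omega) (by omega)).active j
    rw [this]
    exact prototype.quiescent_ne_final
  · rw [hfired j]
    exact prototype.isFinal K j _ r hr'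

end Evolution

end FiringSquad

end PSystem

/-! ### The main theorem -/

theorem theorem1 :
    ∃ (O Q : Type) (_ : Finite O) (_ : Finite Q) (P : PSystem.Prototype O Q) (c : ℕ),
      ∀ (K : Type) [Fintype K] (δ : K → K → Prop), (∀ i, ¬ δ i i) →
        PSystem.StronglyConnected δ → ∀ (g : K) (ev : ℕ → PSystem.Config O Q K),
          PSystem.IsEvolution P.rules δ (P.init δ g) ev →
            ∃ T, P.FiresAt ev T ∧
              (Nontrivial K → T ≤ c * (PSystem.ecc δ g * PSystem.diam δ)) := by
  -- The firing time is at most 2e + 4D + 9. With at least two cells, e and D are positive, so e, D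
  -- and 1 are each at most eD, and 2 + 4 + 9 = 15.
  refine ⟨_, _, inferInstance, inferInstance, PSystem.FiringSquad.prototype, 15, ?_⟩
  intro K _ δ _ hδ g ev hev
  obtain ⟨T, hT, hle⟩ := PSystem.FiringSquad.firesAt hev hδ
  refine ⟨T, hT, fun _ => hle.trans ?_⟩
  have he := PSystem.FiringSquad.ecc_pos hδ g
  have hD := he.trans_le (PSystem.FiringSquad.ecc_le_diam (δ := δ) g)
  nlinarith [Nat.mul_le_mul he hD, Nat.le_mul_of_pos_right (PSystem.ecc δ g) hD,
    Nat.le_mul_of_pos_left (PSystem.diam δ) he]
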